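/- Let $A$ be a complete regular local (Noetherian, commutative) ring of Krull dimension $d$, with maximal ideal $\mathfrak m$ and residue field $k=A/\mathfrak m$. Let $\phi:A\to A$ be a flat local ring endomorphism that induces the identity on $k$. Let $A[X]_\phi$ be the ring of polynomials $\sum_i a_iX^i$ with coefficients $a_i\in A$ and the commutation rule $Xa=\phi(a)X$ for $a\in A$. "Module" means left module. An $A$-module $M$ is called smooth if every finitely generated $A$-submodule of $M$ is Artinian, and admissible if it is smooth and $M[\mathfrak m]=\{x\in M:\ ax=0\ \text{for all } a\in\mathfrak m\}$ is finite-dimensional over $k$. An $A[X]_\phi$-module is called smooth (admissible) if its underlying $A$-module is. For an $A[X]_\phi$-module $M$ and $i\ge 0$, the $k$-vector space $\mathrm{Tor}_i^A(k,M)$ is given the $k[X]$-module structure of $\mathrm{Tor}_i^{A[X]_\phi}(k[X],M)\cong\mathrm{Tor}_i^A(k,M)$, where $A[X]_\phi\to k[X]$ is reduction modulo $\mathfrak m$; in degree $0$, $X$ acts on $k\otimes_A M$ by $X(c\otimes m)=c\otimes Xm$. (1) Let $M$ be a smooth, finitely presented $A[X]_\phi$-module and $N\subseteq M$ a nonzero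 $A[X]_\phi$-submodule such that $M/N$ is a finitely presented $A[X]_\phi$-module and admissible, and such that $\mathrm{Tor}_d^A(k,N)$ is a torsion-free $k[X]$-module. Then $\mathrm{Tor}_0^A(k,M)$ is infinite-dimensional over $k$. (2) In particular (the case $N=M$): if $M$ is a nonzero, smooth, finitely presented $A[X]_\phi$-module such that $\mathrm{Tor}_d^A(k,M)$ is a torsion-free $k[X]$-module, then $\mathrm{Tor}_0^A(k,M)$ is infinite-dimensional over $k$. -/

import Mathlib

open CategoryTheory IsLocalRing
open scoped TensorProduct Polynomial

universe u

noncomputable section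

/-! ## The twisted polynomial ring `A[X]_φ` -/

/-- The ring `A[X]_φ` of polynomials `∑ aᵢ Xⁱ` with coefficients on the left and
the commutation rule `X a = φ(a) X`.  The underlying left `A`-module is that of Mathlib's
`SkewPolynomial A`; the multiplication, which depends on `φ`, is given below. -/
def TwistedPoly {A : Type u} [CommRing A] (_φ : A →+* A) : Type u := SkewPolynomial A

namespace TwistedPoly

variable {A : Type u} [CommRing A]

/-- The action of the monoid `ℕ` on `A` through the powers of `φ`. -/
abbrev powAction (φ : A →+* A) : MulSemiringAction (Multiplicative ℕ) A :=
  MulSemiringAction.compHom A (powersHom (A →+* A) φ)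

instance instRing (φ : A →+* A) : Ring (TwistedPoly φ) :=
  letI := powAction φ
  inferInstanceAs (Ring (SkewPolynomial A))

/-- Multiplication of the coefficients on the left. -/
instance instModule (φ : A →+* A) : Module A (TwistedPoly φ) :=
  inferInstanceAs (Module A (SkewPolynomial A))

/-- The constants `A → A[X]_φ`. -/
def C (φ : A →+* A) : A →+* TwistedPoly φ :=
  letI := powAction φ
  (SkewMonoidAlgebra.singleOneRingHom : A →+* SkewMonoidAlgebra A (Multiplicative ℕ))

/-- The variable `X`. -/
def X (φ : A →+* A) : TwistedPoly φ :=
  (SkewMonoidAlgebra.single (Multiplicative.ofAdd 1) 1 : SkewPolynomial A)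

theorem X_mul_C (φ : A →+* A) (a : A) : X φ * C φ a = C φ (φ a) * X φ := by
  let _ := powAction φ
  have h1 : (Multiplicative.ofAdd 1 : Multiplicative ℕ) • a = φ a := by
    change ((powersHom (A →+* A) φ) (Multiplicative.ofAdd 1)) a = φ a
    simp
  have h : (SkewMonoidAlgebra.single (Multiplicative.ofAdd 1) 1 :
        SkewMonoidAlgebra A (Multiplicative ℕ)) * SkewMonoidAlgebra.single 1 a =
      SkewMonoidAlgebra.single 1 (φ a) * SkewMonoidAlgebra.single (Multiplicative.ofAdd 1) 1 := by
    rw [SkewMonoidAlgebra.single_mul_single, SkewMonoidAlgebra.single_mul_single, h1]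
    simp
  exact h

theorem smul_eq_C_mul (φ : A →+* A) (a : A) (f : TwistedPoly φ) : a • f = C φ a * f := by
  let _ := powAction φ
  have h : ∀ g : SkewMonoidAlgebra A (Multiplicative ℕ),
      a • g = SkewMonoidAlgebra.single 1 a * g := by
    intro g
    induction g using SkewMonoidAlgebra.induction_on with
    | zero => simp
    | single g b => simp [SkewMonoidAlgebra.smul_single, SkewMonoidAlgebra.single_mul_single]
    | add f g hf hg => rw [smul_add, mul_add, hf, hg]
  exact h f

end TwistedPoly

/-! ## Smooth and admissible modules -/

/-- An `A`-module is smooth if all its finitely generated submodules are Artinian. -/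
def IsSmoothModule (A M : Type u) [CommRing A] [AddCommGroup M] [Module A M] : Prop :=
  ∀ P : Submodule A M, P.FG → IsArtinian A P

/-- `M[𝔪]`, the submodule of the elements killed by `𝔪`, as a vector space over `A ⧸ 𝔪`. -/
abbrev MaxTorsion (A M : Type u) [CommRing A] [IsLocalRing A] [AddCommGroup M] [Module A M] :
    Type u :=
  Submodule.torsionBySet A M (maximalIdeal A)

instance MaxTorsion.instModule (A M : Type u) [CommRing A] [IsLocalRing A] [AddCommGroup M]
    [Module A M] : Module (ResidueField A) (MaxTorsion A M) :=
  inferInstanceAs (Module (A ⧸ maximalIdeal A) (Submodule.torsionBySet A M (maximalIdeal A)))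

/-- An `A`-module is admissible if it is smooth and `M[𝔪]` is finite-dimensional over `k`. -/
def IsAdmissibleModule (A M : Type u) [CommRing A] [IsLocalRing A] [AddCommGroup M]
    [Module A M] : Prop :=
  IsSmoothModule A M ∧ FiniteDimensional (ResidueField A) (MaxTorsion A M)

/-! ## The functors `Tor_i(k, -)` with values in `k[X]`-modules -/

namespace TwistedPoly

variable {A : Type u} [CommRing A] [IsLocalRing A] {φ : A →+* A} [IsLocalHom φ]

theorem residue_apply (hφ : ResidueField.map φ = RingHom.id (ResidueField A)) (a : A) :
    residue A (φ a) = residue A a := by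
  rw [← ResidueField.map_residue, hφ, RingHom.id_apply]

/-- The `A`-module underlying an `A[X]_φ`-module. -/
abbrev under (φ : A →+* A) : ModuleCat.{u} (TwistedPoly φ) ⥤ ModuleCat.{u} A :=
  ModuleCat.restrictScalars (C φ)

/-- The operator `c ⊗ m ↦ c ⊗ X m` on `k ⊗_A M`. -/
def xOp (hφ : ResidueField.map φ = RingHom.id (ResidueField A))
    (M : ModuleCat.{u} (TwistedPoly φ)) :
    Module.End (ResidueField A) (ResidueField A ⊗[A] (under φ).obj M) :=
  TensorProduct.AlgebraTensorModule.lift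
    { toFun := fun c =>
        { toFun := fun m => c ⊗ₜ[A] (show (under φ).obj M from X φ • (show M from m))
          map_add' := fun m m' => by
            rw [← TensorProduct.tmul_add]
            exact congrArg (fun z => c ⊗ₜ[A] z) (smul_add (X φ) (show M from m) (show M from m'))
          map_smul' := fun a m => by
            have h : (show (under φ).obj M from X φ • (show M from a • m)) =
                φ a • (show (under φ).obj M from X φ • (show M from m)) := by
              change X φ • (C φ a • (show M from m)) = C φ (φ a) • (X φ • (show M from m))
              rw [← mul_smul, ← mul_smul, X_mul_C]
            rw [h, ← TensorProduct.smul_tmul, RingHom.id_apply, TensorProduct.smul_tmul',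
              Algebra.smul_def, Algebra.smul_def]
            congr 2
            exact residue_apply hφ a }
      map_add' := fun c c' => by
        ext m
        exact TensorProduct.add_tmul _ _ _
      map_smul' := fun r c => by
        ext m
        rfl }

theorem xOp_tmul (hφ : ResidueField.map φ = RingHom.id (ResidueField A))
    (M : ModuleCat.{u} (TwistedPoly φ)) (c : ResidueField A) (m : M) :
    xOp hφ M (c ⊗ₜ[A] (show (under φ).obj M from m)) =
      c ⊗ₜ[A] (show (under φ).obj M from X φ • m) := rfl

/-- The map `k ⊗_A M → k ⊗_A N` induced by an `A[X]_φ`-linear map `M → N`, which commutes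
with the operators of `X`. -/
def reductionMap (hφ : ResidueField.map φ = RingHom.id (ResidueField A))
    {M N : ModuleCat.{u} (TwistedPoly φ)} (f : M ⟶ N) :
    Module.AEval' (xOp hφ M) →ₗ[(ResidueField A)[X]] Module.AEval' (xOp hφ N) :=
  LinearMap.ofAEval (xOp hφ M)
    ((Module.AEval'.of (xOp hφ N)).toLinearMap ∘ₗ
      TensorProduct.AlgebraTensorModule.lTensor (ResidueField A) (ResidueField A)
        ((under φ).map f).hom)
    (fun z => by
      rw [LinearMap.comp_apply, LinearMap.comp_apply, LinearEquiv.coe_coe, Module.AEval'.X_smul_of]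
      congr 1
      induction z using TensorProduct.induction_on with
      | zero => simp
      | tmul c m =>
        exact congrArg (fun n => c ⊗ₜ[A] (show (under φ).obj N from n))
          (map_smul f.hom (X φ) (show M from m))
      | add z w hz hw => rw [smul_add, map_add, map_add, map_add, hz, hw])

/-- The functor `M ↦ k[X] ⊗_{A[X]_φ} M` from left `A[X]_φ`-modules to `k[X]`-modules, where
`A[X]_φ → k[X]` is reduction modulo `𝔪`: its value is `k ⊗_A M`
with `X` acting by `X (c ⊗ m) = c ⊗ X m`. -/
def reduction (hφ : ResidueField.map φ = RingHom.id (ResidueField A)) :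
    ModuleCat.{u} (TwistedPoly φ) ⥤ ModuleCat.{u} (ResidueField A)[X] where
  obj M := ModuleCat.of (ResidueField A)[X] (Module.AEval' (xOp hφ M))
  map {M N} f := ModuleCat.ofHom (reductionMap hφ f)
  map_id M := by
    ext x
    exact LinearMap.congr_fun (TensorProduct.AlgebraTensorModule.lTensor_id) x
  map_comp {M N P} f g := by
    ext x
    exact LinearMap.congr_fun (TensorProduct.AlgebraTensorModule.lTensor_comp
      ((under φ).map g).hom ((under φ).map f).hom) x

instance (hφ : ResidueField.map φ = RingHom.id (ResidueField A)) : (reduction hφ).Additive where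
  map_add {M N f g} := by
    ext x
    exact LinearMap.congr_fun (LinearMap.lTensor_add (ResidueField A)
      ((under φ).map f).hom ((under φ).map g).hom) x

/-- The `k[X]`-module `Tor_i^{A[X]_φ}(k[X], M)`, functorially in `M`: the `i`-th left derived
functor of `M ↦ k[X] ⊗_{A[X]_φ} M = k ⊗_A M`.  It is `Tor_i^A(k, M)`
(see `nonempty_torFunctor_iso` below), and this is the `k[X]`-module structure that
`Tor_i^A(k, M)` carries. -/
def torFunctor (hφ : ResidueField.map φ = RingHom.id (ResidueField A)) (i : ℕ) :
    ModuleCat.{u} (TwistedPoly φ) ⥤ ModuleCat.{u} (ResidueField A)[X] :=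
  (reduction hφ).leftDerived i

/-- `Tor_i^A(k, M)` with its `k[X]`-module structure, for an `A[X]_φ`-module `M`. -/
abbrev TorK (hφ : ResidueField.map φ = RingHom.id (ResidueField A)) (i : ℕ)
    (M : Type u) [AddCommGroup M] [Module (TwistedPoly φ) M] : ModuleCat.{u} (ResidueField A)[X] :=
  (torFunctor hφ i).obj (ModuleCat.of (TwistedPoly φ) M)

/-- The underlying `k`-vector space of a `k[X]`-module. -/
abbrev overField : ModuleCat.{u} (ResidueField A)[X] ⥤ ModuleCat.{u} (ResidueField A) :=
  ModuleCat.restrictScalars Polynomial.C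

end TwistedPoly

/-! ## Comparison with Mathlib's `Tor` over `A` -/

namespace TwistedPoly

theorem under_preservesProjectiveObjects {A : Type u} [CommRing A] {φ : A →+* A} :
     (under φ).PreservesProjectiveObjects where
  projective_obj {P} hP := by
    have hP' : Module.Projective (TwistedPoly φ) P :=
      (IsProjective.iff_projective (R := TwistedPoly φ) P).2 hP
    obtain ⟨s, hs⟩ := hP'.out
    let _ : Module A P := inferInstanceAs (Module A ((under φ).obj P))
    have hsm : ∀ (a : A) (p : P), a • p = C φ a • p := fun _ _ => rfl
    have : Module.Projective A (P →₀ TwistedPoly φ) :=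
      have : Module.Free A (TwistedPoly φ) :=
        inferInstanceAs (Module.Free A (SkewMonoidAlgebra A (Multiplicative ℕ)))
      inferInstance
    have hf : ∀ (a : A) (f : P →₀ TwistedPoly φ), a • f = C φ a • f := fun a f => by
      ext1 p
      exact smul_eq_C_mul φ a (f p)
    have : Module.Projective A P := by
      refine Module.Projective.of_split (R := A) (M := P →₀ TwistedPoly φ)
        { toFun := s, map_add' := map_add s, map_smul' := fun a p => ?_ }
        { toFun := Finsupp.linearCombination (TwistedPoly φ) id
          map_add' := map_add _
          map_smul' := fun a f => ?_ } ?_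
      · rw [hsm, map_smul, RingHom.id_apply, hf]
      · rw [hsm, hf, map_smul, RingHom.id_apply]
      · ext p
        exact hs p
    exact (IsProjective.iff_projective (R := A) ((under φ).obj P)).1 this

variable {A : Type u} [CommRing A] [IsLocalRing A] {φ : A →+* A} [IsLocalHom φ]

/-- The `A`-module underlying a `k[X]`-module. -/
abbrev overBase (A : Type u) [CommRing A] [IsLocalRing A] :
    ModuleCat.{u} (ResidueField A)[X] ⥤ ModuleCat.{u} A :=
  ModuleCat.restrictScalars (algebraMap A (ResidueField A)[X])

/-- Over `A`, the functor `reduction` is `M ↦ k ⊗_A M`. -/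
def reductionIso (hφ : ResidueField.map φ = RingHom.id (ResidueField A)) :
    reduction hφ ⋙ overBase A ≅ under φ ⋙
      (MonoidalCategory.tensoringLeft (ModuleCat.{u} A)).obj (ModuleCat.of A (ResidueField A)) :=
  NatIso.ofComponents (fun M =>
    let f : (overBase A).obj ((reduction hφ).obj M) →ₗ[A] (ResidueField A ⊗[A] (under φ).obj M) :=
      { toFun := fun x => (Module.AEval'.of (xOp hφ M)).symm x
        map_add' := fun _ _ => rfl
        map_smul' := fun a x => by
          have h := Module.AEval.C_smul (xOp hφ M) (residue A a)
            (show Module.AEval' (xOp hφ M) from x)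
          refine (congrArg (Module.AEval'.of (xOp hφ M)).symm h).trans ?_
          rw [map_smul]
          exact algebraMap_smul (ResidueField A) a
            ((Module.AEval'.of (xOp hφ M)).symm (show Module.AEval' (xOp hφ M) from x)) }
    (LinearEquiv.ofBijective f Function.bijective_id).toModuleIso) (by intro M N f; rfl)

/-- The `A`-module underlying `torFunctor hφ i` is `Tor_i^A(k, -)`. -/
theorem nonempty_torFunctor_iso (hφ : ResidueField.map φ = RingHom.id (ResidueField A)) (i : ℕ)
    (M : ModuleCat.{u} (TwistedPoly φ)) :
    Nonempty ((overBase A).obj ((torFunctor hφ i).obj M) ≅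
      ((Tor (ModuleCat.{u} A) i).obj (ModuleCat.of A (ResidueField A))).obj
        ((under φ).obj M)) := by
  have := under_preservesProjectiveObjects (φ := φ)
  have : Limits.PreservesFiniteLimits (under φ) ∧ Limits.PreservesFiniteColimits (under φ) :=
    ((Functor.exact_tfae (under φ)).out 1 3).mp fun S h => by
      rw [ShortComplex.ShortExact.moduleCat_exact_iff_function_exact] at h ⊢
      exact h
  obtain ⟨_, _⟩ := this
  let P := projectiveResolution M
  let K := ((reduction hφ).mapHomologicalComplex (ComplexShape.down ℕ)).obj P.complex
  let K' := ((overBase A).mapHomologicalComplex (ComplexShape.down ℕ)).obj K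
  let L := ((MonoidalCategory.tensoringLeft (ModuleCat.{u} A)).obj
    (ModuleCat.of A (ResidueField A))).mapHomologicalComplex (ComplexShape.down ℕ) |>.obj
      (((under φ).mapHomologicalComplex (ComplexShape.down ℕ)).obj P.complex)
  let e : K' ≅ L := HomologicalComplex.Hom.isoOfComponents
    (fun n => (reductionIso hφ).app (P.complex.X n))
    (fun n m _ => ((reductionIso hφ).hom.naturality (P.complex.d n m)).symm)
  let e0 : (overBase A).obj (K.homology i) ≅ K'.homology i :=
    ((K.sc i).mapHomologyIso (overBase A)).symm
  exact ⟨(overBase A).mapIso (P.isoLeftDerivedObj (reduction hφ) i) ≪≫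
    e0 ≪≫
    (HomologicalComplex.homologyFunctor _ _ i).mapIso e ≪≫
    (((under φ).mapProjectiveResolution P).isoLeftDerivedObj
      ((MonoidalCategory.tensoringLeft (ModuleCat.{u} A)).obj
        (ModuleCat.of A (ResidueField A))) i).symm⟩

end TwistedPoly

end

/-! Write `k` for the residue field and `φ*V` for the extension of scalars of `V` along `φ`. Suppose
that `k ⊗ M` is finite-dimensional; the aim is `N = 0`. Since `M/N` is finitely presented, `N` is
finitely generated over `A[X]_φ`. Since `M/N` is admissible, it is Artinian over `A`, so the kernel
of `N/𝔪N → M/𝔪M` is finite and `N/𝔪N` is finite-dimensional.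

The maximal ideal is generated by a regular sequence of length `d`, so `Tor_d(k, V)` is the socle
`V[𝔪]`, naturally in `V` (`comparison_residueField`). The complexes `k ⊗ P` and `k ⊗ φ*P` are
isomorphic, because `φ` is the identity on `k`. Hence `V` and `φ*V` have isomorphic socles, and the
action of `X` on `Tor_d(k, N)` becomes the map induced on socles by the linearization `φ*N → N`, `a
⊗ n ↦ aXn`. Torsion-freeness makes this map injective on socles. As `φ*N` is `𝔪`-power torsion
(flatness forces `𝔪^s ⊆ φ(𝔪)A`), the linearization itself is injective (`lift_xMap_injective`).

Consequently, for an `A`-submodule `W ⊆ N`, the span of `XW` (`shift`) is a copy of `φ*W`, and its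
socle has the same length as that of `W`. If moreover `W` is finitely generated and `W ⊆ shift W`,
the shifts of `W` increase without enlarging the socle, so their union has its socle inside `W`. To
produce such a submodule, let a finitely generated `W` generate `N` both over `A[X]_φ` and modulo
`𝔪`. Nakayama gives `N = W + shift^n N` for every `n`. Since `W` is Artinian, the chain `shift^n N`
becomes stationary at some `L = shift L`, which is contained in the union of the shifts of a
finitely generated `U ⊆ shift U`. The socle of `L` is then finitely generated and `N/L` is a
quotient of `W`, so the socle of `N` is finitely generated (`socle_fg`).

Thus `Tor_d(k, N)` is a torsion-free `k[X]`-module of finite dimension over `k`, hence zero. A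
smooth module with zero socle is zero, so `N = 0`. -/

noncomputable section

/-! ## Regular local rings -/

namespace IsRegularLocalRing

open RingTheory.Sequence

/-- Modulo an element `x ∉ 𝔪²` of the maximal ideal, the embedding dimension drops. -/
theorem spanFinrank_maximalIdeal_quotient_lt {R : Type u} [CommRing R] [IsLocalRing R]
    [IsNoetherianRing R] {x : R} (hx : x ∈ maximalIdeal R) (hx2 : x ∉ maximalIdeal R ^ 2)
    [IsLocalRing (R ⧸ Ideal.span {x})] :
    (maximalIdeal (R ⧸ Ideal.span {x})).spanFinrank + 1 ≤ (maximalIdeal R).spanFinrank := by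
  let k := ResidueField R
  let v : CotangentSpace R := (maximalIdeal R).toCotangent ⟨x, hx⟩
  have hv : v ≠ 0 := fun h => hx2 (((maximalIdeal R).toCotangent_eq_zero ⟨x, hx⟩).1 h)
  let V' := CotangentSpace R ⧸ Submodule.span k {v}
  have hdim : Module.finrank k V' + 1 = (maximalIdeal R).spanFinrank := by
    rw [spanFinrank_maximalIdeal_eq_finrank_cotangentSpace,
      ← Submodule.finrank_quotient_add_finrank (Submodule.span k {v}), finrank_span_singleton hv]
  let b := Module.finBasis k V'
  have hlift : ∀ i, ∃ y : maximalIdeal R,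
      (Submodule.span k {v}).mkQ ((maximalIdeal R).toCotangent y) = b i := fun i => by
    obtain ⟨w, hw⟩ := (Submodule.span k {v}).mkQ_surjective (b i)
    obtain ⟨y, hy⟩ := (maximalIdeal R).toCotangent_surjective w
    exact ⟨y, by rw [hy, hw]⟩
  choose y hy using hlift
  -- Nakayama: `x` together with lifts of a basis of the cotangent space modulo the class of `x`
  -- generates `𝔪`.
  have hspan : Submodule.span R (insert ⟨x, hx⟩ (Set.range y)) = ⊤ := by
    rw [← CotangentSpace.span_image_eq_top_iff, Set.image_insert_eq, Submodule.span_insert,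
      ← Submodule.map_mkQ_eq_top, Submodule.map_span, ← Set.range_comp, ← Set.range_comp,
      ← b.span_eq]
    congr 2
    ext1 i
    exact hy i
  have hmax : maximalIdeal (R ⧸ Ideal.span {x}) =
      Ideal.span (Set.range fun i => Ideal.Quotient.mk (Ideal.span {x}) (y i : R)) := by
    have h1 : maximalIdeal R = Ideal.span (insert x (Set.range fun i => (y i : R))) := by
      have h := congrArg (Submodule.map (maximalIdeal R).subtype) hspan
      rw [Submodule.map_span, Submodule.map_top, Submodule.range_subtype, Set.image_insert_eq,
        ← Set.range_comp] at h
      exact h.symm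
    have h2 : (maximalIdeal R).map (Ideal.Quotient.mk (Ideal.span {x})) =
        maximalIdeal (R ⧸ Ideal.span {x}) := by
      have hs : Function.Surjective (Ideal.Quotient.mk (Ideal.span {x})) :=
        Ideal.Quotient.mk_surjective
      have : IsLocalHom (Ideal.Quotient.mk (Ideal.span {x})) := hs.isLocalHom
      rw [← maximalIdeal_comap (Ideal.Quotient.mk (Ideal.span {x})),
        Ideal.map_comap_of_surjective _ hs]
    refine (h2.symm.trans (congrArg _ h1)).trans ?_
    rw [Ideal.map_span, Set.image_insert_eq, Ideal.span_insert,
      Ideal.Quotient.eq_zero_iff_mem.2 (Ideal.mem_span_singleton_self x),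
      Ideal.span_singleton_eq_bot.2 rfl, bot_sup_eq, ← Set.range_comp]
    rfl
  rw [hmax, ← hdim]
  refine Nat.add_le_add_right ?_ 1
  refine (Submodule.spanFinrank_span_le_ncard_of_finite (Set.finite_range _)).trans ?_
  rw [← Set.image_univ]
  refine (Set.ncard_image_le Set.finite_univ).trans ?_
  rw [Set.ncard_univ, Nat.card_eq_fintype_card, Fintype.card_fin]

/-- A regular local ring of positive dimension has elements of `𝔪` outside `𝔪²` and outside all
minimal primes. -/
theorem exists_mem_maximalIdeal_notMem {R : Type u} [CommRing R] [IsRegularLocalRing R]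
    (h0 : (maximalIdeal R).spanFinrank ≠ 0) :
    ∃ x ∈ maximalIdeal R, x ∉ maximalIdeal R ^ 2 ∧ ∀ p ∈ minimalPrimes R, x ∉ p := by
  by_contra! hcon
  have hsub : (maximalIdeal R : Set R) ⊆
      ⋃ p ∈ insert (maximalIdeal R ^ 2) (minimalPrimes R), (id p : Ideal R) := fun x hx => by
    by_cases hx2 : x ∈ maximalIdeal R ^ 2
    · exact Set.mem_biUnion (Set.mem_insert _ _) hx2
    · obtain ⟨p, hp, hxp⟩ := hcon x hx hx2
      exact Set.mem_biUnion (Set.mem_insert_of_mem _ hp) hxp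
  have hfin : (insert (maximalIdeal R ^ 2) (minimalPrimes R)).Finite :=
    (Ideal.finite_minimalPrimes_of_isNoetherianRing R ⊥).insert _
  -- Prime avoidance tolerates two ideals that need not be prime; `𝔪²` fills both places.
  obtain ⟨p, hp, hle⟩ := (Ideal.subset_union_prime_finite hfin (maximalIdeal R ^ 2)
    (maximalIdeal R ^ 2) (fun p hp hne _ =>
      (hp.resolve_left hne).1.1)).1 hsub
  have hbot : maximalIdeal R = ⊥ → False := fun h => h0 (by rw [h]; exact Submodule.spanFinrank_bot)
  rcases hp with rfl | hp
  -- Here `𝔪 ⊆ 𝔪²`, so `𝔪 = 0` by Nakayama.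
  · refine hbot (Submodule.eq_bot_of_le_smul_of_le_jacobson_bot (maximalIdeal R) _
      (IsNoetherian.noetherian _) ?_ (maximalIdeal_le_jacobson ⊥))
    simpa [pow_two] using hle
  -- Here `𝔪` is a minimal prime, so the dimension is zero, and by regularity so is the number of
  -- generators of `𝔪`.
  · have hpm : p = maximalIdeal R := le_antisymm (le_maximalIdeal hp.1.1.ne_top) hle
    have hh : (maximalIdeal R).height = 0 := by
      rw [← hpm]
      have := hp.1.1
      exact Ideal.height_eq_zero_iff.2 hp
    have h2 : ((maximalIdeal R).height : WithBot ℕ∞) = ringKrullDim R :=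
      maximalIdeal_height_eq_ringKrullDim
    rw [← IsRegularLocalRing.spanFinrank_maximalIdeal, hh] at h2
    exact h0 (by exact_mod_cast h2.symm)

/-- Divide by `x` outside `𝔪²` and all minimal primes: the embedding dimension drops by at least one
and the Krull dimension by at most one, so the quotient is again regular. The induction carries the
domain property along because it makes `(x)` prime, from which `R` is a domain and `x` is regular.
-/
theorem isDomain_and_exists_isWeaklyRegular (n : ℕ) :
    ∀ (R : Type u) [CommRing R] [IsRegularLocalRing R], (maximalIdeal R).spanFinrank = n →
      IsDomain R ∧ ∃ rs : List R, rs.length = n ∧ IsWeaklyRegular R rs ∧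
        Ideal.ofList rs = maximalIdeal R := by
  induction n with
  | zero =>
    intro R _ _ h
    have hb : maximalIdeal R = ⊥ :=
      (Submodule.spanFinrank_eq_zero_iff_eq_bot (IsNoetherian.noetherian _)).1 h
    exact ⟨(isField_iff_maximalIdeal_eq.2 hb).isDomain, [], rfl, .nil _ _, by
      rw [hb, Ideal.ofList_nil]⟩
  | succ n ih =>
    intro R _ _ h
    obtain ⟨x, hx, hx2, hxp⟩ := exists_mem_maximalIdeal_notMem (R := R) (by omega)
    have hspan : Ideal.span {x} ≤ maximalIdeal R := (Ideal.span_singleton_le_iff_mem _).2 hx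
    have : Nontrivial (R ⧸ Ideal.span {x}) :=
      Ideal.Quotient.nontrivial_iff.2 fun h => (maximalIdeal.isMaximal R).ne_top
        (top_le_iff.1 (h ▸ hspan))
    have hs : Function.Surjective (Ideal.Quotient.mk (Ideal.span {x})) :=
      Ideal.Quotient.mk_surjective
    have : IsLocalRing (R ⧸ Ideal.span {x}) := .of_surjective' _ hs
    have hle := spanFinrank_maximalIdeal_quotient_lt hx hx2
    have hdim : ringKrullDim R ≤ ringKrullDim (R ⧸ Ideal.span {x}) + 1 := by
      have := ringKrullDim_le_ringKrullDim_quotient_add_card {x}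
        (by simpa [ringJacobson_eq_maximalIdeal] using hx)
      rwa [Finset.card_singleton, Nat.cast_one, Finset.coe_singleton] at this
    have hle' : (maximalIdeal (R ⧸ Ideal.span {x})).spanFinrank ≤ n := by omega
    have hge : (n : WithBot ℕ∞) ≤ ringKrullDim (R ⧸ Ideal.span {x}) := by
      rw [← IsRegularLocalRing.spanFinrank_maximalIdeal, h, Nat.cast_succ] at hdim
      exact ENat.WithBot.add_le_add_natCast_right_iff.1 hdim
    have : IsRegularLocalRing (R ⧸ Ideal.span {x}) :=
      of_spanFinrank_maximalIdeal_le _ (le_trans (by exact_mod_cast hle') hge)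
    have heq : (maximalIdeal (R ⧸ Ideal.span {x})).spanFinrank = n := by
      refine le_antisymm hle' ?_
      rw [← IsRegularLocalRing.spanFinrank_maximalIdeal] at hge
      exact_mod_cast hge
    obtain ⟨hdom, rs, hlen, hreg, hmax⟩ := ih (R ⧸ Ideal.span {x}) heq
    have hprime : (Ideal.span {x}).IsPrime := (Ideal.Quotient.isDomain_iff_prime _).1 hdom
    have hR : IsDomain R := by
      -- A minimal prime `p ⊆ (x)` with `x ∉ p` satisfies `p = xp`, so `p = 0` by Nakayama.
      obtain ⟨p, hp, hpx⟩ := Ideal.exists_minimalPrimes_le (bot_le : ⊥ ≤ Ideal.span {x})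
      have hxp' := hxp p hp
      have hpp := hp.1.1
      have hp0 : p = ⊥ := by
        refine Submodule.eq_bot_of_le_smul_of_le_jacobson_bot (Ideal.span {x}) _
          (IsNoetherian.noetherian _) (fun y hy => ?_)
          (hspan.trans (maximalIdeal_le_jacobson ⊥))
        obtain ⟨a, rfl⟩ := Ideal.mem_span_singleton'.1 (hpx hy)
        rw [mul_comm]
        exact Submodule.smul_mem_smul (Ideal.mem_span_singleton_self x)
          ((hpp.mem_or_mem hy).resolve_right hxp')
      rw [hp0] at hpp
      exact IsDomain.of_bot_isPrime R
    choose g hg using hs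
    refine ⟨hR, x :: rs.map g, by simp [hlen], ?_, ?_⟩
    · rw [isWeaklyRegular_cons_iff']
      have hx0 : x ≠ 0 := fun h => hx2 (h ▸ zero_mem _)
      refine ⟨IsSMulRegular.of_ne_zero hx0, ?_⟩
      have hrs : (rs.map g).map (Ideal.Quotient.mk (Ideal.span {x})) = rs := by
        rw [List.map_map]
        exact (List.map_congr_left fun a _ => hg a).trans (List.map_id rs)
      rw [hrs]
      have e : QuotSMulTop x R ≃ₗ[R] (R ⧸ Ideal.span {x}) :=
        Submodule.quotEquivOfEq _ _ (by simp [← Submodule.ideal_span_singleton_smul])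
      refine (LinearEquiv.isWeaklyRegular_congr
        (e.extendScalarsOfSurjective Ideal.Quotient.mk_surjective) rs).2 hreg
    · have hmap : (Ideal.ofList (x :: rs.map g)).map (Ideal.Quotient.mk (Ideal.span {x})) =
          maximalIdeal (R ⧸ Ideal.span {x}) := by
        rw [Ideal.map_ofList, List.map_cons, List.map_map, Ideal.ofList_cons,
          Ideal.Quotient.eq_zero_iff_mem.2 (Ideal.mem_span_singleton_self x),
          Ideal.span_singleton_eq_bot.2 rfl, bot_sup_eq, ← hmax]
        congr 1
        exact (List.map_congr_left fun a _ => hg a).trans (List.map_id rs)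
      have hc := congrArg (Ideal.comap (Ideal.Quotient.mk (Ideal.span {x}))) hmap
      have : IsLocalHom (Ideal.Quotient.mk (Ideal.span {x})) :=
        Function.Surjective.isLocalHom _ Ideal.Quotient.mk_surjective
      rw [maximalIdeal_comap (Ideal.Quotient.mk (Ideal.span {x})),
        Ideal.comap_map_of_surjective _ Ideal.Quotient.mk_surjective, ← RingHom.ker_eq_comap_bot,
        Ideal.mk_ker, sup_eq_left.2] at hc
      · exact hc
      · rw [Ideal.ofList_cons]
        exact le_sup_left

/-- The maximal ideal of a regular local ring is generated by a regular sequence. -/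
theorem exists_isWeaklyRegular (A : Type u) [CommRing A] [IsRegularLocalRing A] (d : ℕ)
    (hd : ringKrullDim A = d) :
    ∃ rs : List A, rs.length = d ∧ IsWeaklyRegular A rs ∧ Ideal.ofList rs = maximalIdeal A := by
  refine (isDomain_and_exists_isWeaklyRegular d A ?_).2
  rw [← IsRegularLocalRing.spanFinrank_maximalIdeal] at hd
  exact_mod_cast hd

/-- The closed fibre of a flat local endomorphism of a regular local ring has dimension zero. -/
theorem exists_pow_le_map_maximalIdeal {A : Type u} [CommRing A] [IsRegularLocalRing A]
    (φ : A →+* A) [IsLocalHom φ] (hflat : φ.Flat) :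
    ∃ n, maximalIdeal A ^ n ≤ (maximalIdeal A).map φ := by
  obtain ⟨rs, hlen, hreg, hmax⟩ := (isDomain_and_exists_isWeaklyRegular _ A rfl).2
  -- Flatness carries the regular sequence generating `𝔪` to a regular sequence generating `φ(𝔪)A`.
  -- Its length is `dim A`, so the quotient has dimension zero.
  have hreg' : IsWeaklyRegular A (rs.map φ) :=
    @IsWeaklyRegular.of_flat A A _ _ φ.toAlgebra hflat rs hreg
  have hmem : ∀ r ∈ rs.map φ, r ∈ maximalIdeal A := by
    intro r hr
    obtain ⟨s, hs, rfl⟩ := List.mem_map.1 hr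
    have : s ∈ maximalIdeal A := hmax ▸ Ideal.subset_span hs
    rw [← maximalIdeal_comap φ] at this
    exact this
  have hR := IsRegular.of_isWeaklyRegular_of_mem_maximalIdeal A hmem hreg'
  have hdim := ringKrullDim_add_length_eq_ringKrullDim_of_isRegular _ hR
  rw [List.length_map, hlen, ← Ideal.map_ofList, hmax,
    ← IsRegularLocalRing.spanFinrank_maximalIdeal (R := A)] at hdim
  have h0 : ringKrullDim (A ⧸ (maximalIdeal A).map φ) ≤ (0 : ℕ) := by
    refine ENat.WithBot.add_le_add_natCast_right_iff (c := (maximalIdeal A).spanFinrank).1 ?_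
    rw [hdim, Nat.cast_zero, zero_add]
  have hd0 : Ring.KrullDimLE 0 (A ⧸ (maximalIdeal A).map φ) := Ring.krullDimLE_iff.2 h0
  refine Ideal.exists_pow_le_of_le_radical_of_fg ?_ (IsNoetherian.noetherian _)
  rw [Ideal.radical_eq_sInf]
  -- In dimension zero every prime containing `φ(𝔪)A` is maximal, hence equal to `𝔪`.
  refine le_sInf fun p ⟨hle, hp⟩ => ?_
  have hker : RingHom.ker (Ideal.Quotient.mk ((maximalIdeal A).map φ)) ≤ p := by
    rwa [Ideal.mk_ker]
  have hp' := Ring.krullDimLE_zero_iff.1 hd0 _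
    (Ideal.map_isPrime_of_surjective Ideal.Quotient.mk_surjective hker)
  have hm := Ideal.comap_isMaximal_of_surjective (Ideal.Quotient.mk ((maximalIdeal A).map φ))
    Ideal.Quotient.mk_surjective (H := hp')
  rw [Ideal.comap_map_of_surjective _ Ideal.Quotient.mk_surjective, ← RingHom.ker_eq_comap_bot,
    sup_eq_left.2 hker] at hm
  exact (eq_maximalIdeal hm).ge

end IsRegularLocalRing

/-! ## Modules with torsion by powers of the maximal ideal -/

/-- Every element of a smooth module is killed by a power of `𝔪`. -/
theorem IsSmoothModule.exists_pow_smul_eq_zero {A M : Type u} [CommRing A] [IsLocalRing A]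
    [IsNoetherianRing A] [AddCommGroup M] [Module A M] (h : IsSmoothModule A M) (v : M) :
    ∃ n, ∀ a ∈ maximalIdeal A ^ n, a • v = 0 := by
  have := h (Submodule.span A {v}) (Submodule.fg_span_singleton v)
  -- The chain `𝔪ⁿ · Av` stabilizes because `Av` is Artinian, and Nakayama makes its stable value
  -- zero.
  let f : ℕ →o (Submodule A (Submodule.span A {v}))ᵒᵈ :=
    ⟨fun n => OrderDual.toDual (maximalIdeal A ^ n • ⊤), fun i j hij =>
      Submodule.smul_mono_left (Ideal.pow_le_pow_right hij)⟩
  obtain ⟨n, hn⟩ := IsArtinian.monotone_stabilizes f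
  have hn1 : maximalIdeal A ^ n • (⊤ : Submodule A (Submodule.span A {v})) =
      maximalIdeal A ^ (n + 1) • ⊤ := hn (n + 1) n.le_succ
  have hfin : Module.Finite A (Submodule.span A {v}) :=
    Module.Finite.iff_fg.2 (Submodule.fg_span_singleton v)
  have h0 : maximalIdeal A ^ n • (⊤ : Submodule A (Submodule.span A {v})) = ⊥ := by
    refine Submodule.eq_bot_of_le_smul_of_le_jacobson_bot (maximalIdeal A) _
      (IsNoetherian.noetherian _) ?_ (maximalIdeal_le_jacobson ⊥)
    rw [← Submodule.mul_smul, ← pow_succ', ← hn1]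
  refine ⟨n, fun a ha => ?_⟩
  have hmem : a • (⟨v, Submodule.mem_span_singleton_self v⟩ : Submodule.span A {v}) ∈
      maximalIdeal A ^ n • (⊤ : Submodule A (Submodule.span A {v})) :=
    Submodule.smul_mem_smul ha trivial
  rw [h0, Submodule.mem_bot] at hmem
  exact congrArg Subtype.val hmem

/-- A nonzero module with `𝔪`-power torsion has a nonzero socle. -/
theorem exists_ne_zero_smul_eq_zero {A M : Type u} [CommRing A] [IsLocalRing A]
    [AddCommGroup M] [Module A M] {v : M} (hv : v ≠ 0) {n : ℕ}
    (hn : ∀ a ∈ maximalIdeal A ^ n, a • v = 0) :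
    ∃ a : A, a • v ≠ 0 ∧ ∀ b ∈ maximalIdeal A, b • a • v = 0 := by
  classical
  have hex : ∃ n, ∀ a ∈ maximalIdeal A ^ n, a • v = 0 := ⟨n, hn⟩
  have hspec := Nat.find_spec hex
  have hne : Nat.find hex ≠ 0 := fun h => hv (by
    have := hspec 1 (by rw [h, pow_zero, Ideal.one_eq_top]; trivial)
    rwa [one_smul] at this)
  -- With `j + 1` the least exponent killing `v`, any element of `𝔪^j` not killing `v` moves it into
  -- the socle.
  obtain ⟨j, hj⟩ := Nat.exists_eq_succ_of_ne_zero hne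
  have hmin := Nat.find_min hex (m := j) (by omega)
  push Not at hmin
  obtain ⟨a, ha, hav⟩ := hmin
  refine ⟨a, hav, fun b hb => ?_⟩
  rw [← mul_smul]
  refine hspec _ ?_
  rw [hj, pow_succ']
  exact Ideal.mul_mem_mul hb ha

/-! ### Macaulay inverse systems: submodules of `M` against submodules of `k[X₁, …, X_d]^r` -/

namespace InverseSystem

variable {A M : Type u} [CommRing A] [AddCommGroup M] [Module A M] {d r : ℕ} (x : Fin d → A)

/-- The monomial `x ^ α`. -/
def mon (α : Fin d →₀ ℕ) : A := ∏ i, x i ^ α i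

theorem mon_single_add (i : Fin d) (α : Fin d →₀ ℕ) :
    mon x (Finsupp.single i 1 + α) = x i * mon x α := by
  classical
  simp only [mon, Finsupp.add_apply, pow_add, Finset.prod_mul_distrib]
  congr 1
  rw [Finset.prod_eq_single i]
  · simp
  · intro j _ hj
    simp [hj.symm]
  · simp

/-- The exponents of total degree `n`. -/
def expo (d n : ℕ) : Finset (Fin d →₀ ℕ) := Finset.univ.finsuppAntidiag n

theorem mem_expo {n : ℕ} {α : Fin d →₀ ℕ} : α ∈ expo d n ↔ ∑ i, α i = n := by
  simp [expo, Finset.mem_finsuppAntidiag]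

theorem single_add_mem_expo {n : ℕ} (i : Fin d) {α : Fin d →₀ ℕ} :
    Finsupp.single i 1 + α ∈ expo d (n + 1) ↔ α ∈ expo d n := by
  classical
  simp [mem_expo, Finset.sum_add_distrib, Finsupp.single_apply, add_comm 1]

theorem mon_mem_pow {I : Ideal A} (hx : ∀ i, x i ∈ I) {n : ℕ} {α : Fin d →₀ ℕ}
    (hα : α ∈ expo d n) : mon x α ∈ I ^ n := by
  rw [← mem_expo.1 hα, ← Finset.prod_pow_eq_pow_sum]
  exact Ideal.prod_mem_prod fun i _ => Ideal.pow_mem_pow (hx i) _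

variable (M) in
/-- The elements killed by all monomials of degree `n`. -/
def layer (n : ℕ) : Submodule A M where
  carrier := {v | ∀ α ∈ expo d n, mon x α • v = 0}
  zero_mem' := fun α _ => smul_zero _
  add_mem' := fun hv hw α hα => by rw [smul_add, hv α hα, hw α hα, add_zero]
  smul_mem' := fun a v hv α hα => by rw [smul_comm, hv α hα, smul_zero]

theorem smul_mem_layer {n : ℕ} {v : M} (hv : v ∈ layer M x (n + 1)) (i : Fin d) :
    x i • v ∈ layer M x n := fun α hα => by
  rw [← mul_smul, mul_comm, ← mon_single_add]
  exact hv _ ((single_add_mem_expo i).2 hα)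

variable [IsLocalRing A]

theorem mon_smul_mem {n : ℕ} (hx : Ideal.span (Set.range x) = maximalIdeal A) {v : M}
    (hv : v ∈ layer M x (n + 1)) {α : Fin d →₀ ℕ} (hα : α ∈ expo d n) :
    mon x α • v ∈ Submodule.torsionBySet A M (maximalIdeal A) := by
  have h : mon x α • v ∈ Submodule.torsionBySet A M (Set.range x) := by
    rw [Submodule.mem_torsionBySet_iff]
    rintro ⟨a, i, rfl⟩
    change x i • mon x α • v = 0
    rw [← mul_smul, ← mon_single_add]
    exact hv _ ((single_add_mem_expo i).2 hα)
  rwa [Submodule.torsionBySet_eq_torsionBySet_span, hx] at h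

/-- The coordinates of an element of the socle, extended by zero. -/
def coord (b : Module.Basis (Fin r) (ResidueField A) (MaxTorsion A M)) (v : M) (j : Fin r) :
    ResidueField A := by
  classical
  exact if h : v ∈ Submodule.torsionBySet A M (maximalIdeal A) then b.repr ⟨v, h⟩ j else 0

variable (b : Module.Basis (Fin r) (ResidueField A) (MaxTorsion A M))

theorem coord_add {v w : M} (hv : v ∈ Submodule.torsionBySet A M (maximalIdeal A))
    (hw : w ∈ Submodule.torsionBySet A M (maximalIdeal A)) (j : Fin r) :
    coord b (v + w) j = coord b v j + coord b w j := by
  rw [coord, coord, coord, dif_pos hv, dif_pos hw, dif_pos (add_mem hv hw), ← Finsupp.add_apply,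
    ← map_add]
  rfl

theorem coord_smul {v : M} (hv : v ∈ Submodule.torsionBySet A M (maximalIdeal A)) (a : A)
    (j : Fin r) : coord b (a • v) j = residue A a * coord b v j := by
  rw [coord, coord, dif_pos hv, dif_pos (Submodule.smul_mem _ a hv), ← smul_eq_mul,
    ← Finsupp.smul_apply, ← map_smul]
  rfl

theorem eq_zero_of_coord {v : M} (hv : v ∈ Submodule.torsionBySet A M (maximalIdeal A))
    (h : ∀ j, coord b v j = 0) : v = 0 := by
  have h0 : (⟨v, hv⟩ : MaxTorsion A M) = 0 := by
    refine b.repr.map_eq_zero_iff.1 (Finsupp.ext fun j => ?_)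
    have := h j
    rwa [coord, dif_pos hv] at this
  exact congrArg Subtype.val h0

/-- The pairing of vectors of polynomials with elements of the module. -/
def pairing (n : ℕ) (v : M) :
    (Fin r → MvPolynomial (Fin d) (ResidueField A)) →ₗ[ResidueField A] ResidueField A :=
  ∑ j, ∑ α ∈ expo d n, coord b (mon x α • v) j •
    (MvPolynomial.lcoeff (ResidueField A) α ∘ₗ LinearMap.proj j)

theorem pairing_apply (n : ℕ) (v : M) (g : Fin r → MvPolynomial (Fin d) (ResidueField A)) :
    pairing x b n v g = ∑ j, ∑ α ∈ expo d n, coord b (mon x α • v) j * (g j).coeff α := by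
  simp [pairing, LinearMap.sum_apply]

theorem pairing_zero_X_smul (v : M) (i : Fin d)
    (g : Fin r → MvPolynomial (Fin d) (ResidueField A)) :
    pairing x b 0 v ((MvPolynomial.X i : MvPolynomial (Fin d) (ResidueField A)) • g) = 0 := by
  classical
  rw [pairing_apply]
  refine Finset.sum_eq_zero fun j _ => Finset.sum_eq_zero fun α hα => ?_
  have : α i = 0 := by
    rw [mem_expo, Finset.sum_eq_zero_iff] at hα
    exact hα i (Finset.mem_univ i)
  rw [Pi.smul_apply, smul_eq_mul, MvPolynomial.coeff_X_mul', if_neg (by simpa using this), mul_zero]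

/-- Multiplication by `X i` is adjoint to the action of `x i`, by the shift `α ↦ α + e_i` of
exponents. This, with its degree-zero counterpart, makes `orth` a submodule over the polynomial
ring. -/
theorem pairing_succ_X_smul (n : ℕ) (v : M) (i : Fin d)
    (g : Fin r → MvPolynomial (Fin d) (ResidueField A)) :
    pairing x b (n + 1) v ((MvPolynomial.X i : MvPolynomial (Fin d) (ResidueField A)) • g) =
      pairing x b n (x i • v) g := by
  classical
  rw [pairing_apply, pairing_apply]
  refine Finset.sum_congr rfl fun j _ => ?_
  symm
  refine Finset.sum_of_injOn (fun α => Finsupp.single i 1 + α)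
    (fun α _ β _ h => add_left_cancel h) (fun α hα => (single_add_mem_expo i).2 hα) ?_ ?_
  · intro α hα hnot
    rw [Pi.smul_apply, smul_eq_mul, MvPolynomial.coeff_X_mul', if_neg, mul_zero]
    intro hi
    refine hnot ⟨α - Finsupp.single i 1, ?_, ?_⟩
    · rw [Finset.mem_coe, ← single_add_mem_expo i, add_tsub_cancel_of_le]
      · exact hα
      · rw [Finsupp.single_le_iff]
        exact Nat.one_le_iff_ne_zero.2 (Finsupp.mem_support_iff.1 hi)
    · refine add_tsub_cancel_of_le ?_
      rw [Finsupp.single_le_iff]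
      exact Nat.one_le_iff_ne_zero.2 (Finsupp.mem_support_iff.1 hi)
  · intro α _
    rw [Pi.smul_apply, smul_eq_mul, MvPolynomial.coeff_X_mul, mon_single_add, mul_comm (x i),
      mul_smul]

/-- The vectors of polynomials orthogonal to a submodule. -/
def orth (V : Submodule A M) :
    Submodule (MvPolynomial (Fin d) (ResidueField A))
      (Fin r → MvPolynomial (Fin d) (ResidueField A)) where
  carrier := {g | ∀ n, ∀ v ∈ V, v ∈ layer M x (n + 1) → pairing x b n v g = 0}
  zero_mem' := fun n v _ _ => map_zero _
  add_mem' := fun hg hh n v hv hl => by rw [map_add, hg n v hv hl, hh n v hv hl, add_zero]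
  smul_mem' := fun p => by
    induction p using MvPolynomial.induction_on with
    | C a =>
      intro g hg n v hv hl
      have : (MvPolynomial.C a : MvPolynomial (Fin d) (ResidueField A)) • g = a • g := by
        ext1 j
        rw [Pi.smul_apply, Pi.smul_apply, smul_eq_mul, MvPolynomial.C_mul']
      rw [this, map_smul, hg n v hv hl, smul_zero]
    | add p q hp hq =>
      intro g hg n v hv hl
      rw [add_smul, map_add, hp hg n v hv hl, hq hg n v hv hl, add_zero]
    | mul_X p i hp =>
      intro g hg
      rw [mul_smul]
      refine hp ?_
      intro n v hv hl
      cases n with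
      | zero => exact pairing_zero_X_smul x b v i g
      | succ n =>
        rw [pairing_succ_X_smul]
        exact hg n _ (V.smul_mem _ hv) (smul_mem_layer x hl i)

theorem orth_anti {V W : Submodule A M} (h : V ≤ W) : orth x b W ≤ orth x b V :=
  fun _ hg n v hv hl => hg n v (h hv) hl

/-- An element of layer `n + 1` is determined modulo layer `n` by the socle coordinates of its
products with the monomials of degree `n`. If those of `v ∈ W` did not occur in `V`, a linear
functional would separate them, and this functional is pairing with a homogeneous vector of
polynomials in `orth V` but not in `orth W`. -/
theorem layer_le_of_orth_le (hx : Ideal.span (Set.range x) = maximalIdeal A)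
    {V W : Submodule A M} (hVW : V ≤ W) (h : orth x b V ≤ orth x b W) (n : ℕ) :
    ∀ v ∈ W, v ∈ layer M x n → v ∈ V := by
  classical
  induction n with
  | zero =>
    intro v _ hl
    have h0 := hl 0 (mem_expo.2 (by simp))
    rw [mon] at h0
    simp only [Finsupp.coe_zero, Pi.zero_apply, pow_zero, Finset.prod_const_one, one_smul] at h0
    rw [h0]
    exact zero_mem _
  | succ n ih =>
    intro v hv hl
    let cv : M → (Fin r × expo d n → ResidueField A) := fun w p => coord b (mon x p.2 • w) p.1
    let U : Submodule (ResidueField A) (Fin r × expo d n → ResidueField A) :=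
      { carrier := cv '' {w | w ∈ V ∧ w ∈ layer M x (n + 1)}
        zero_mem' := ⟨0, ⟨zero_mem _, zero_mem _⟩, by
          ext p
          have := coord_smul b (zero_mem (Submodule.torsionBySet A M (maximalIdeal A))) 0 p.1
          simpa [cv] using this⟩
        add_mem' := by
          rintro _ _ ⟨w, ⟨hw, hwl⟩, rfl⟩ ⟨w', ⟨hw', hwl'⟩, rfl⟩
          refine ⟨w + w', ⟨add_mem hw hw', add_mem hwl hwl'⟩, ?_⟩
          ext p
          simp only [cv, Pi.add_apply, smul_add]
          exact coord_add b (mon_smul_mem x hx hwl p.2.2) (mon_smul_mem x hx hwl' p.2.2) _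
        smul_mem' := by
          rintro a _ ⟨w, ⟨hw, hwl⟩, rfl⟩
          obtain ⟨a, rfl⟩ := residue_surjective a
          refine ⟨a • w, ⟨V.smul_mem _ hw, Submodule.smul_mem _ _ hwl⟩, ?_⟩
          ext p
          simp only [cv, Pi.smul_apply, smul_comm _ a]
          exact coord_smul b (mon_smul_mem x hx hwl p.2.2) _ _ }
    have hmem : cv v ∈ U := by
      by_contra hnot
      obtain ⟨f, hfv, hfU⟩ := Submodule.exists_le_ker_of_notMem hnot
      -- The vector of forms of degree `n` whose coefficients are the values of `f` on the standard
      -- basis, so that pairing with it in degree `n` is `f ∘ cv`.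
      let g : Fin r → MvPolynomial (Fin d) (ResidueField A) := fun j =>
        ∑ α : expo d n, MvPolynomial.monomial α.1 (f (fun q => if (j, α) = q then 1 else 0))
      have hg0 : ∀ j β, β ∉ expo d n → (g j).coeff β = 0 := fun j β hβ => by
        simp only [g, MvPolynomial.coeff_sum, MvPolynomial.coeff_monomial]
        refine Finset.sum_eq_zero fun α _ => if_neg ?_
        rintro rfl
        exact hβ α.2
      have hg1 : ∀ j (β : expo d n), (g j).coeff β =
          f (fun q => if (j, β) = q then 1 else 0) := fun j β => by
        simp only [g, MvPolynomial.coeff_sum, MvPolynomial.coeff_monomial]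
        rw [Finset.sum_eq_single β]
        · simp
        · intro α _ hα
          exact if_neg fun h => hα (Subtype.ext h)
        · simp
      have hpair : ∀ w, pairing x b n w g = f (cv w) := fun w => by
        rw [LinearMap.pi_apply_eq_sum_univ f, pairing_apply, Fintype.sum_prod_type]
        refine Finset.sum_congr rfl fun j _ => ?_
        rw [← Finset.sum_coe_sort (expo d n)]
        refine Finset.sum_congr rfl fun β _ => ?_
        rw [hg1, smul_eq_mul]
      have hgV : g ∈ orth x b V := by
        intro n' w hw hwl
        by_cases hn : n' = n
        · subst hn
          rw [hpair]
          exact hfU ⟨w, ⟨hw, hwl⟩, rfl⟩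
        · rw [pairing_apply]
          refine Finset.sum_eq_zero fun j _ => Finset.sum_eq_zero fun α hα => ?_
          rw [hg0 j α, mul_zero]
          intro hα'
          exact hn ((mem_expo.1 hα).symm.trans (mem_expo.1 hα'))
      exact hfv ((hpair v).symm.trans (h hgV n v hv hl))
    obtain ⟨w, ⟨hw, hwl⟩, hcw⟩ := hmem
    -- Equal coordinates in degree `n` place `v - w` in layer `n`, where the induction hypothesis
    -- applies.
    have hsub : v - w ∈ V := by
      refine ih _ (sub_mem hv (hVW hw)) fun α hα => ?_
      have hS := mon_smul_mem x hx hwl hα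
      refine eq_zero_of_coord b (mon_smul_mem x hx (sub_mem hl hwl) hα) fun j => ?_
      have h1 := coord_add b (mon_smul_mem x hx (sub_mem hl hwl) hα) hS j
      rw [← smul_add, sub_add_cancel] at h1
      have h2 : coord b (mon x α • w) j = coord b (mon x α • v) j := congrFun hcw (j, ⟨α, hα⟩)
      rw [h2] at h1
      exact (add_eq_right.1 h1.symm)
    have := add_mem hsub hw
    rwa [sub_add_cancel] at this

end InverseSystem

/-- A module with `𝔪`-power torsion and finite-dimensional socle is Artinian. -/
theorem isArtinian_of_finite_maxTorsion {A M : Type u} [CommRing A] [IsLocalRing A]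
    [IsNoetherianRing A] [AddCommGroup M] [Module A M]
    (htors : ∀ v : M, ∃ n, ∀ a ∈ maximalIdeal A ^ n, a • v = 0)
    (hfin : FiniteDimensional (ResidueField A) (MaxTorsion A M)) : IsArtinian A M := by
  obtain ⟨d, x, hx⟩ := Submodule.fg_iff_exists_fin_generating_family.1
    (IsNoetherian.noetherian (maximalIdeal A))
  let b := Module.finBasis (ResidueField A) (MaxTorsion A M)
  -- A strictly decreasing chain in `M` would give a strictly increasing chain in the Noetherian
  -- module `k[X₁, …, X_d]^r`.
  have hanti : StrictAnti (InverseSystem.orth x b) := by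
    intro V W hVW
    refine lt_of_le_of_ne (InverseSystem.orth_anti x b hVW.le) fun h => ?_
    refine hVW.not_ge fun v hv => ?_
    obtain ⟨n, hn⟩ := htors v
    refine InverseSystem.layer_le_of_orth_le x b hx hVW.le h.ge n v hv fun α hα => hn _ ?_
    refine InverseSystem.mon_mem_pow x (fun i => ?_) hα
    rw [← hx]
    exact Submodule.subset_span ⟨i, rfl⟩
  have : WellFoundedLT (Submodule A M) := hanti.wellFoundedLT
  exact this

theorem IsAdmissibleModule.isArtinian {A M : Type u} [CommRing A] [IsLocalRing A]
    [IsNoetherianRing A] [AddCommGroup M] [Module A M] (h : IsAdmissibleModule A M) :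
    IsArtinian A M :=
  isArtinian_of_finite_maxTorsion h.1.exists_pow_smul_eq_zero h.2

/-- An Artinian module killed by `𝔪` is finitely generated. -/
theorem finite_of_isArtinian_of_smul_eq_zero {A L : Type u} [CommRing A] [IsLocalRing A]
    [AddCommGroup L] [Module A L] [IsArtinian A L]
    (h : ∀ a ∈ maximalIdeal A, ∀ v : L, a • v = 0) : Module.Finite A L := by
  have ht : Module.IsTorsionBySet A L (maximalIdeal A) := fun v a => h a a.2 v
  let _ : Module (ResidueField A) L := ht.module
  have : IsScalarTower A (ResidueField A) L := ht.isScalarTower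
  have : IsArtinian (ResidueField A) L := isArtinian_of_tower A ‹_›
  have : Module.Finite (ResidueField A) L := IsSemisimpleModule.finite_tfae.out 2 0 |>.1 ‹_›
  exact Module.Finite.trans (ResidueField A) L

/-- If `M/𝔪M` is finitely generated and `M/N` is Artinian, then `N/𝔪N` is finitely generated. -/
theorem exists_fg_sup_smul_of_isArtinian_quotient {A M : Type u} [CommRing A] [IsLocalRing A]
    [IsNoetherianRing A] [AddCommGroup M] [Module A M] (N : Submodule A M)
    [IsArtinian A (M ⧸ N)] (hM : Module.Finite A (M ⧸ maximalIdeal A • (⊤ : Submodule A M))) :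
    ∃ W : Submodule A M, W.FG ∧ W ≤ N ∧ N ≤ W ⊔ maximalIdeal A • N := by
  obtain ⟨d, x, hx⟩ := Submodule.fg_iff_exists_fin_generating_family.1
    (IsNoetherian.noetherian (maximalIdeal A))
  have hxm : ∀ i, x i ∈ maximalIdeal A := fun i => hx ▸ Submodule.subset_span ⟨i, rfl⟩
  -- The map `(v_i) ↦ ∑ x_i v_i`, whose image contains `𝔪M`.
  let s : (Fin d → M) →ₗ[A] M := ∑ i, x i • LinearMap.proj i
  have hs : ∀ v, s v = ∑ i, x i • v i := fun v => by simp [s]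
  have hrange : maximalIdeal A • (⊤ : Submodule A M) ≤ LinearMap.range s := by
    refine Submodule.smul_le.2 fun a ha v _ => ?_
    rw [← hx, Submodule.mem_span_range_iff_exists_fun] at ha
    obtain ⟨c, rfl⟩ := ha
    refine ⟨fun i => c i • v, ?_⟩
    rw [hs, Finset.sum_smul]
    exact Finset.sum_congr rfl fun i _ => by rw [← mul_smul, smul_eq_mul, mul_comm]
  let π := (maximalIdeal A • N).mkQ
  let f : (M ⧸ maximalIdeal A • N) →ₗ[A] (M ⧸ maximalIdeal A • (⊤ : Submodule A M)) :=
    Submodule.factor (Submodule.smul_mono le_rfl le_top)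
  -- This intersection is `(N ∩ 𝔪M)/𝔪N`, the kernel of `N/𝔪N → M/𝔪M`. It is a quotient of the image
  -- of `s⁻¹(N)` in `(M/N)^d`, since tuples with entries in `N` go to `𝔪N`. So it is Artinian and
  -- killed by `𝔪`, hence finitely generated.
  have hinf : (N.map π ⊓ LinearMap.ker f).FG := by
    let K := N.comap s
    let L := N.map π ⊓ LinearMap.ker f
    have hmem : ∀ v : K, π (s v) ∈ L := fun v => by
      refine ⟨⟨s v, v.2, rfl⟩, ?_⟩
      change Submodule.Quotient.mk (s v) = 0
      rw [Submodule.Quotient.mk_eq_zero, hs]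
      exact sum_mem fun i _ => Submodule.smul_mem_smul (hxm i) trivial
    let g : K →ₗ[A] L := LinearMap.codRestrict L (π ∘ₗ s ∘ₗ K.subtype) hmem
    let h : K →ₗ[A] (Fin d → M ⧸ N) :=
      LinearMap.pi (fun i => N.mkQ ∘ₗ LinearMap.proj i) ∘ₗ K.subtype
    have hgh : LinearMap.ker h ≤ LinearMap.ker g := by
      intro v hv
      have hv' : ∀ i, (v : Fin d → M) i ∈ N := fun i =>
        (Submodule.Quotient.mk_eq_zero N).1 (congrFun (LinearMap.mem_ker.1 hv) i)
      refine LinearMap.mem_ker.2 (Subtype.ext ?_)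
      change π (s v) = 0
      rw [Submodule.mkQ_apply, Submodule.Quotient.mk_eq_zero, hs]
      exact sum_mem fun i _ => Submodule.smul_mem_smul (hxm i) (hv' i)
    have hgs : Function.Surjective g := by
      rintro ⟨_, ⟨v, hv, rfl⟩, hker⟩
      change Submodule.Quotient.mk v = 0 at hker
      rw [Submodule.Quotient.mk_eq_zero] at hker
      obtain ⟨w, rfl⟩ := hrange hker
      exact ⟨⟨w, hv⟩, rfl⟩
    have : IsArtinian A (K ⧸ LinearMap.ker h) :=
      isArtinian_of_injective h.quotKerEquivRange.toLinearMap h.quotKerEquivRange.injective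
    have : IsArtinian A L := isArtinian_of_surjective _ ((LinearMap.ker h).liftQ g hgh) (by
      intro l
      obtain ⟨v, rfl⟩ := hgs l
      exact ⟨(LinearMap.ker h).mkQ v, Submodule.liftQ_apply _ _ _⟩)
    refine Module.Finite.iff_fg.1 (finite_of_isArtinian_of_smul_eq_zero (L := L) ?_)
    rintro a ha ⟨_, ⟨v, hv, rfl⟩, _⟩
    refine Subtype.ext ?_
    change a • π v = 0
    rw [← map_smul, Submodule.mkQ_apply, Submodule.Quotient.mk_eq_zero]
    exact Submodule.smul_mem_smul ha hv
  have hfg : (N.map π).FG :=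
    Submodule.fg_of_fg_map_of_fg_inf_ker f (IsNoetherian.noetherian _) hinf
  obtain ⟨n, y, hy⟩ := Submodule.fg_iff_exists_fin_generating_family.1 hfg
  have hlift : ∀ i, ∃ z ∈ N, π z = y i := fun i =>
    (hy ▸ Submodule.subset_span ⟨i, rfl⟩ : y i ∈ N.map π)
  choose z hzN hz using hlift
  refine ⟨Submodule.span A (Set.range z), Submodule.fg_span (Set.finite_range z),
    Submodule.span_le.2 (by rintro _ ⟨i, rfl⟩; exact hzN i), ?_⟩
  have hmap : (Submodule.span A (Set.range z)).map π = N.map π := by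
    rw [Submodule.map_span, ← Set.range_comp, ← hy]
    congr 2
    ext1 i
    exact hz i
  intro v hv
  have h1 : π v ∈ (Submodule.span A (Set.range z)).map π := hmap ▸ ⟨v, hv, rfl⟩
  obtain ⟨w, hw, hwv⟩ := h1
  have h2 : v - w ∈ maximalIdeal A • N := (Submodule.Quotient.eq _).1 hwv.symm
  rw [← add_sub_cancel w v]
  exact Submodule.add_mem_sup hw h2

/-! ## The socle as a top `Tor` -/

namespace TensorComplex

variable {A : Type u} [CommRing A]

/-- Tensoring a chain complex with a module. -/
abbrev tensor (Y : ModuleCat.{u} A) :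
    ChainComplex (ModuleCat.{u} A) ℕ ⥤ ChainComplex (ModuleCat.{u} A) ℕ :=
  ((MonoidalCategory.tensoringLeft (ModuleCat.{u} A)).obj Y).mapHomologicalComplex
    (ComplexShape.down ℕ)

/-- The map of complexes induced by a map of modules. -/
abbrev tensorMap {Y Z : ModuleCat.{u} A} (g : Y ⟶ Z) (P : ChainComplex (ModuleCat.{u} A) ℕ) :
    (tensor Y).obj P ⟶ (tensor Z).obj P :=
  (NatTrans.mapHomologicalComplex ((MonoidalCategory.tensoringLeft (ModuleCat.{u} A)).map g)
    (ComplexShape.down ℕ)).app P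

/-- The short complex of complexes obtained by tensoring with a short complex of modules. -/
def tensorShort (S : ShortComplex (ModuleCat.{u} A)) (P : ChainComplex (ModuleCat.{u} A) ℕ) :
    ShortComplex (ChainComplex (ModuleCat.{u} A) ℕ) :=
  ShortComplex.mk (tensorMap S.f P) (tensorMap S.g P) (by
    ext n : 1
    change ((MonoidalCategory.tensoringLeft (ModuleCat.{u} A)).map S.f).app (P.X n) ≫
      ((MonoidalCategory.tensoringLeft (ModuleCat.{u} A)).map S.g).app (P.X n) = 0
    rw [← NatTrans.comp_app, ← Functor.map_comp, S.zero]
    simp)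

/-- The map of short complexes induced by a map of complexes. -/
def tensorShortMap (S : ShortComplex (ModuleCat.{u} A)) {P P' : ChainComplex (ModuleCat.{u} A) ℕ}
    (f : P ⟶ P') : tensorShort S P ⟶ tensorShort S P' where
  τ₁ := (tensor S.X₁).map f
  τ₂ := (tensor S.X₂).map f
  τ₃ := (tensor S.X₃).map f
  comm₁₂ := (NatTrans.mapHomologicalComplex
    ((MonoidalCategory.tensoringLeft (ModuleCat.{u} A)).map S.f) (ComplexShape.down ℕ)).naturality f
  comm₂₃ := (NatTrans.mapHomologicalComplex
    ((MonoidalCategory.tensoringLeft (ModuleCat.{u} A)).map S.g) (ComplexShape.down ℕ)).naturality f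

/-- Projective terms are flat, so exactness holds degree by degree. -/
theorem tensorShort_shortExact {S : ShortComplex (ModuleCat.{u} A)} (hS : S.ShortExact)
    {P : ChainComplex (ModuleCat.{u} A) ℕ} (hP : ∀ n, Projective (P.X n)) :
    (tensorShort S P).ShortExact := by
  refine HomologicalComplex.shortExact_of_degreewise_shortExact _ fun n => ?_
  have hproj : Module.Projective A (P.X n) :=
    (IsProjective.iff_projective (R := A) (P.X n)).2 (hP n)
  have hex := (ShortComplex.ShortExact.moduleCat_exact_iff_function_exact S).1 hS.exact
  refine ShortComplex.ShortExact.mk' ?_ ?_ ?_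
  · rw [ShortComplex.ShortExact.moduleCat_exact_iff_function_exact]
    exact Module.Flat.rTensor_exact (P.X n) hex
  · rw [ModuleCat.mono_iff_injective]
    exact Module.Flat.rTensor_preserves_injective_linearMap S.f.hom
      ((ModuleCat.mono_iff_injective _).1 hS.mono_f)
  · rw [ModuleCat.epi_iff_surjective]
    exact LinearMap.rTensor_surjective _ ((ModuleCat.epi_iff_surjective _).1 hS.epi_g)

/-- Homology of the tensor product, as a functor of the complex. -/
abbrev tor (Y : ModuleCat.{u} A) (i : ℕ) :
    ChainComplex (ModuleCat.{u} A) ℕ ⥤ ModuleCat.{u} A :=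
  tensor Y ⋙ HomologicalComplex.homologyFunctor _ _ i

/-- The homology of `Y ⊗ P` vanishes above degree `j`, and in degree `j` it is naturally the
`I`-torsion in `V`. -/
structure Comparison {P P' : ChainComplex (ModuleCat.{u} A) ℕ} (f : P ⟶ P')
    {V V' : ModuleCat.{u} A} (g : V ⟶ V') (Y : ModuleCat.{u} A) (I : Ideal A) (j : ℕ) : Prop where
  isZero : ∀ i, j < i → Limits.IsZero ((tor Y i).obj P)
  isZero' : ∀ i, j < i → Limits.IsZero ((tor Y i).obj P')
  exists_hom : ∃ (ψ : (tor Y j).obj P ⟶ V) (ψ' : (tor Y j).obj P' ⟶ V'),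
    Function.Injective ψ.hom ∧ Function.Injective ψ'.hom ∧
    (∀ v, v ∈ LinearMap.range ψ.hom ↔ ∀ a ∈ I, a • v = 0) ∧
    (∀ v, v ∈ LinearMap.range ψ'.hom ↔ ∀ a ∈ I, a • v = 0) ∧
    ψ ≫ g = (tor Y j).map f ≫ ψ'

namespace Comparison

variable {P P' : ChainComplex (ModuleCat.{u} A) ℕ} {f : P ⟶ P'} {V V' : ModuleCat.{u} A}
  {g : V ⟶ V'} {Y Z : ModuleCat.{u} A} {I : Ideal A} {j : ℕ}

/-- An isomorphism of modules induces isomorphisms of functors. -/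
def torIso (e : Y ≅ Z) (i : ℕ) : tor Y i ≅ tor Z i :=
  Functor.isoWhiskerRight (NatIso.mapHomologicalComplex
    ((MonoidalCategory.tensoringLeft (ModuleCat.{u} A)).mapIso e) (ComplexShape.down ℕ)) _

theorem of_natIso (h : Comparison f g Y I j) (e : ∀ i, tor Z i ≅ tor Y i) :
    Comparison f g Z I j where
  isZero i hi := (h.isZero i hi).of_iso ((e i).app P)
  isZero' i hi := (h.isZero' i hi).of_iso ((e i).app P')
  exists_hom := by
    obtain ⟨ψ, ψ', hψ, hψ', hr, hr', hc⟩ := h.exists_hom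
    have hb : ∀ Q, Function.Bijective ((e j).hom.app Q).hom := fun Q =>
      (((e j).app Q).toLinearEquiv).bijective
    refine ⟨(e j).hom.app P ≫ ψ, (e j).hom.app P' ≫ ψ', ?_, ?_, ?_, ?_, ?_⟩
    · rw [ModuleCat.hom_comp, LinearMap.coe_comp]
      exact hψ.comp (hb P).1
    · rw [ModuleCat.hom_comp, LinearMap.coe_comp]
      exact hψ'.comp (hb P').1
    · rwa [ModuleCat.hom_comp, LinearMap.range_comp, LinearMap.range_eq_top.2 (hb P).2,
        Submodule.map_top]
    · rwa [ModuleCat.hom_comp, LinearMap.range_comp, LinearMap.range_eq_top.2 (hb P').2,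
        Submodule.map_top]
    · rw [Category.assoc, hc, ← Category.assoc, ← Category.assoc, (e j).hom.naturality]

theorem homologyMap_tensorMap_smul (x : A) (P : ChainComplex (ModuleCat.{u} A) ℕ) (i : ℕ) :
    HomologicalComplex.homologyMap (tensorMap (x • 𝟙 Y) P) i =
      x • 𝟙 (((tensor Y).obj P).homology i) := by
  have : tensorMap (x • 𝟙 Y) P = x • 𝟙 ((tensor Y).obj P) := by
    ext n : 1
    change MonoidalCategory.whiskerRight (x • 𝟙 Y) (P.X n) =
      x • 𝟙 (MonoidalCategory.tensorObj Y (P.X n))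
    rw [MonoidalLinear.smul_whiskerRight, MonoidalCategory.id_whiskerRight]
  rw [this]
  refine (ShortComplex.homologyMap_smul
    (𝟙 (((tensor Y).obj P).sc i)) x).trans ?_
  rw [ShortComplex.homologyMap_id]
  rfl

/-- By exactness the image of `δ` is the kernel of `x` on `L`, and `ψ` identifies `L` with the
`I`-torsion of `V`; what remains is torsion for `I` and `x` together. -/
theorem range_comp_of_exact {T L V : Type u} [AddCommGroup T] [AddCommGroup L] [AddCommGroup V]
    [Module A T] [Module A L] [Module A V] {δ : T →ₗ[A] L} {m : L →ₗ[A] L} {x : A}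
    (hm : ∀ c, m c = x • c) (hex : Function.Exact δ m) {ψ : L →ₗ[A] V}
    (hψ : Function.Injective ψ) (hr : ∀ v, v ∈ LinearMap.range ψ ↔ ∀ a ∈ I, a • v = 0) (v : V) :
    v ∈ LinearMap.range (ψ ∘ₗ δ) ↔ ∀ a ∈ I ⊔ Ideal.span {x}, a • v = 0 := by
  refine ⟨?_, fun hv => ?_⟩
  · rintro ⟨c, rfl⟩ a ha
    obtain ⟨b, hb, y, hy, rfl⟩ := Submodule.mem_sup.1 ha
    obtain ⟨t, rfl⟩ := Ideal.mem_span_singleton'.1 hy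
    have h1 : x • δ c = 0 := by
      rw [← hm]
      exact (hex _).2 ⟨c, rfl⟩
    rw [LinearMap.comp_apply, add_smul, (hr _).1 ⟨_, rfl⟩ b hb, zero_add, mul_smul,
      ← map_smul ψ x, h1, map_zero, smul_zero]
  · obtain ⟨c, rfl⟩ := (hr v).2 fun a ha => hv a (Submodule.mem_sup_left ha)
    have h1 : x • c = 0 := hψ (by
      rw [map_smul, map_zero]
      exact hv x (Submodule.mem_sup_right (Ideal.mem_span_singleton_self x)))
    rw [← hm] at h1
    obtain ⟨c', hc'⟩ := (hex c).1 h1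
    exact ⟨c', congrArg ψ hc'⟩

theorem down_rel (j : ℕ) : (ComplexShape.down ℕ).Rel (j + 1) j := rfl

/-- The connecting map of the long exact sequence obtained from multiplication by `x`. -/
theorem exists_delta (h0 : ∀ i, j < i → Limits.IsZero ((tor Y i).obj P)) {x : A} {π : Y ⟶ Z}
    {w : (x • 𝟙 Y) ≫ π = 0} (hT : (tensorShort (ShortComplex.mk (x • 𝟙 Y) π w) P).ShortExact)
    {ψ : (tor Y j).obj P ⟶ V} (hψ : Function.Injective ψ.hom)
    (hr : ∀ v, v ∈ LinearMap.range ψ.hom ↔ ∀ a ∈ I, a • v = 0) :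
    Function.Injective (ψ.hom ∘ₗ (hT.δ (j + 1) j (down_rel j)).hom) ∧
    ∀ v, v ∈ LinearMap.range (ψ.hom ∘ₗ (hT.δ (j + 1) j (down_rel j)).hom) ↔
      ∀ a ∈ I ⊔ Ideal.span {x}, a • v = 0 := by
  -- The term preceding `δ` is the homology of `Y ⊗ P` in degree `j + 1`, which vanishes.
  have hδ : Function.Injective (hT.δ (j + 1) j (down_rel j)).hom :=
    (ModuleCat.mono_iff_injective _).1 (hT.mono_δ _ _ (down_rel j) (h0 _ j.lt_succ_self))
  have hex := (ShortComplex.ShortExact.moduleCat_exact_iff_function_exact _).1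
    (hT.homology_exact₁ (j + 1) j (down_rel j))
  refine ⟨?_, range_comp_of_exact (fun c => ?_) hex hψ hr⟩
  · exact hψ.comp hδ
  · exact congrArg (fun z => z.hom c) (homologyMap_tensorMap_smul x P j)

/-- The long exact sequence of `0 → Y → Y → Z → 0`, with `x` as first map: the homology of `Z ⊗ P`
vanishes above degree `j + 1`, and in degree `j + 1` it is the kernel of `x` on the degree `j`
homology of `Y ⊗ P`. Naturality of the connecting map preserves the compatibility with `f`. -/
theorem step (h : Comparison f g Y I j) (hP : ∀ n, Projective (P.X n))
    (hP' : ∀ n, Projective (P'.X n)) {x : A} {π : Y ⟶ Z} (w : (x • 𝟙 Y) ≫ π = 0)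
    (hS : (ShortComplex.mk (x • 𝟙 Y) π w).ShortExact) :
    Comparison f g Z (I ⊔ Ideal.span {x}) (j + 1) := by
  have hT := tensorShort_shortExact hS hP
  have hT' := tensorShort_shortExact hS hP'
  refine ⟨fun i hi => ?_, fun i hi => ?_, ?_⟩
  · obtain ⟨i, rfl⟩ := Nat.exists_eq_succ_of_ne_zero (by omega : i ≠ 0)
    exact @Limits.IsZero.of_mono _ _ _ _ _ (hT.δ (i + 1) i (down_rel i))
      (hT.mono_δ (i + 1) i (down_rel i) (h.isZero _ (by omega))) (h.isZero i (by omega))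
  · obtain ⟨i, rfl⟩ := Nat.exists_eq_succ_of_ne_zero (by omega : i ≠ 0)
    exact @Limits.IsZero.of_mono _ _ _ _ _ (hT'.δ (i + 1) i (down_rel i))
      (hT'.mono_δ (i + 1) i (down_rel i) (h.isZero' _ (by omega))) (h.isZero' i (by omega))
  · obtain ⟨ψ, ψ', hψ, hψ', hr, hr', hc⟩ := h.exists_hom
    obtain ⟨h1, h2⟩ := exists_delta h.isZero hT hψ hr
    obtain ⟨h1', h2'⟩ := exists_delta h.isZero' hT' hψ' hr'
    refine ⟨hT.δ (j + 1) j (down_rel j) ≫ ψ, hT'.δ (j + 1) j (down_rel j) ≫ ψ',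
      h1, h1', h2, h2', ?_⟩
    have hn := HomologicalComplex.HomologySequence.δ_naturality (tensorShortMap
      (ShortComplex.mk (x • 𝟙 Y) π w) f) hT hT' (j + 1) j (down_rel j)
    refine (Category.assoc _ _ _).trans ((congrArg _ hc).trans ?_)
    refine (Category.assoc _ _ _).symm.trans ((congrArg (fun z => z ≫ ψ') hn).trans ?_)
    exact Category.assoc _ _ _

/-- Tensoring with the unit. -/
def tensorUnitIso : tensor (MonoidalCategoryStruct.tensorUnit (ModuleCat.{u} A)) ≅ 𝟭 _ :=
  (NatIso.mapHomologicalComplex (MonoidalCategory.leftUnitorNatIso (ModuleCat.{u} A)) _) ≪≫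
    Functor.mapHomologicalComplexIdIso _ _

theorem comp_comm_of_squares {𝒞 : Type*} [Category* 𝒞] {X Y Z W X' Y' Z' W' : 𝒞} {a : X ⟶ Y}
    {b : Y ⟶ Z} {c : Z ⟶ W} {a' : X' ⟶ Y'} {b' : Y' ⟶ Z'} {c' : Z' ⟶ W'} {x : X ⟶ X'} {y : Y ⟶ Y'}
    {z : Z ⟶ Z'} {w : W ⟶ W'} (h₁ : x ≫ a' = a ≫ y) (h₂ : y ≫ b' = b ≫ z) (h₃ : z ≫ c' = c ≫ w) :
    (a ≫ b ≫ c) ≫ w = x ≫ a' ≫ b' ≫ c' := by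
  rw [Category.assoc, Category.assoc, ← h₃, ← reassoc_of% h₂, ← reassoc_of% h₁]

/-- Start of the induction on the regular sequence: tensoring a resolution with `A` leaves only `V`
in degree zero, and every element is torsion for the zero ideal. -/
theorem base (P : ProjectiveResolution V) (P' : ProjectiveResolution V')
    (f : P.complex ⟶ P'.complex)
    (hf : f ≫ P'.π = P.π ≫ (ChainComplex.single₀ (ModuleCat.{u} A)).map g) :
    Comparison f g (MonoidalCategoryStruct.tensorUnit (ModuleCat.{u} A)) ⊥ 0 := by
  let e (i : ℕ) : tor (MonoidalCategoryStruct.tensorUnit (ModuleCat.{u} A)) i ≅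
    HomologicalComplex.homologyFunctor _ _ i :=
      Functor.isoWhiskerRight tensorUnitIso _ ≪≫ Functor.leftUnitor _
  have hz : ∀ {V : ModuleCat.{u} A} (P : ProjectiveResolution V) (i : ℕ), 0 < i → Limits.IsZero
      ((tor (MonoidalCategoryStruct.tensorUnit (ModuleCat.{u} A)) i).obj P.complex) := by
    intro V P i hi
    obtain ⟨i, rfl⟩ := Nat.exists_eq_succ_of_ne_zero hi.ne'
    exact ((P.complex_exactAt_succ i).isZero_homology).of_iso ((e _).app _)
  let ρ {V : ModuleCat.{u} A} (P : ProjectiveResolution V) : P.complex.homology 0 ≅ V :=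
    asIso (HomologicalComplex.homologyMap P.π 0) ≪≫
      (HomologicalComplex.homologyFunctorSingleIso (ModuleCat.{u} A) (ComplexShape.down ℕ) 0).app V
  let ψ {V : ModuleCat.{u} A} (P : ProjectiveResolution V) :
    (tor (MonoidalCategoryStruct.tensorUnit (ModuleCat.{u} A)) 0).obj P.complex ≅ V :=
      (e 0).app _ ≪≫ ρ P
  have hb : ∀ {V : ModuleCat.{u} A} (P : ProjectiveResolution V),
      Function.Bijective (ψ P).hom.hom := fun P => (ψ P).toLinearEquiv.bijective
  have hr : ∀ {V : ModuleCat.{u} A} (P : ProjectiveResolution V) (v : V),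
      v ∈ LinearMap.range (ψ P).hom.hom ↔ ∀ a ∈ (⊥ : Ideal A), a • v = 0 := fun P v =>
    ⟨fun _ a ha => by rw [(Submodule.mem_bot A).1 ha, zero_smul],
      fun _ => (hb P).2 v⟩
  refine ⟨hz P, hz P', (ψ P).hom, (ψ P').hom, (hb P).1, (hb P').1, hr P, hr P', ?_⟩
  let s := HomologicalComplex.homologyFunctorSingleIso (ModuleCat.{u} A) (ComplexShape.down ℕ) 0
  have h1 : (tor (MonoidalCategoryStruct.tensorUnit (ModuleCat.{u} A)) 0).map f ≫
      (e 0).hom.app P'.complex = (e 0).hom.app P.complex ≫ HomologicalComplex.homologyMap f 0 :=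
    (e 0).hom.naturality f
  have h2 : HomologicalComplex.homologyMap f 0 ≫ HomologicalComplex.homologyMap P'.π 0 =
      HomologicalComplex.homologyMap P.π 0 ≫ HomologicalComplex.homologyMap
        ((ChainComplex.single₀ (ModuleCat.{u} A)).map g) 0 := by
    rw [← HomologicalComplex.homologyMap_comp, hf, HomologicalComplex.homologyMap_comp]
  have h3 : HomologicalComplex.homologyMap ((ChainComplex.single₀ (ModuleCat.{u} A)).map g) 0 ≫
      s.hom.app V' = s.hom.app V ≫ g := s.hom.naturality g
  exact comp_comm_of_squares h1 h2 h3

/-- Multiplication by a regular element on `A ⧸ I`. -/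
theorem quotient_shortExact {I J : Ideal A} {x : A} (hx : IsSMulRegular (A ⧸ I) x)
    (hJ : J = I ⊔ Ideal.span {x}) :
    ∃ (π : ModuleCat.of A (A ⧸ I) ⟶ ModuleCat.of A (A ⧸ J))
      (w : (x • 𝟙 (ModuleCat.of A (A ⧸ I))) ≫ π = 0),
      (ShortComplex.mk (x • 𝟙 (ModuleCat.of A (A ⧸ I))) π w).ShortExact := by
  subst hJ
  let p : (A ⧸ I) →ₗ[A] (A ⧸ (I ⊔ Ideal.span {x})) := Submodule.factor le_sup_left
  have hp : ∀ a : A, p (Submodule.Quotient.mk a) = Submodule.Quotient.mk a := fun a => rfl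
  have hw : (x • 𝟙 (ModuleCat.of A (A ⧸ I))) ≫ ModuleCat.ofHom p = 0 := by
    refine ModuleCat.hom_ext (LinearMap.ext fun a => ?_)
    obtain ⟨a, rfl⟩ := Submodule.Quotient.mk_surjective _ a
    change p (x • Submodule.Quotient.mk a) = 0
    rw [← Submodule.Quotient.mk_smul, hp, Submodule.Quotient.mk_eq_zero, smul_eq_mul]
    exact Ideal.mul_mem_right _ _ (Submodule.mem_sup_right (Ideal.mem_span_singleton_self x))
  refine ⟨ModuleCat.ofHom p, hw, ShortComplex.ShortExact.mk' ?_ ?_ ?_⟩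
  · rw [ShortComplex.ShortExact.moduleCat_exact_iff_function_exact]
    refine fun a => ⟨fun ha => ?_, ?_⟩
    · obtain ⟨a, rfl⟩ := Submodule.Quotient.mk_surjective _ a
      change p (Submodule.Quotient.mk a) = 0 at ha
      rw [hp, Submodule.Quotient.mk_eq_zero] at ha
      obtain ⟨b, hb, y, hy, rfl⟩ := Submodule.mem_sup.1 ha
      obtain ⟨t, rfl⟩ := Ideal.mem_span_singleton'.1 hy
      refine ⟨Submodule.Quotient.mk t, ?_⟩
      change x • (Submodule.Quotient.mk t : A ⧸ I) = Submodule.Quotient.mk (b + t * x)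
      rw [← Submodule.Quotient.mk_smul, Submodule.Quotient.mk_add,
        (Submodule.Quotient.mk_eq_zero _).2 hb, zero_add, smul_eq_mul, mul_comm]
    · rintro ⟨a, rfl⟩
      exact congrArg (fun z => z.hom a) hw
  · rw [ModuleCat.mono_iff_injective]
    exact hx
  · rw [ModuleCat.epi_iff_surjective]
    exact Submodule.factor_surjective le_sup_left

/-- The sequence is extended at its end, since the next element is regular on the quotient by the
preceding ones; each extension is one application of `step`. -/
theorem ofList {f : P ⟶ P'}
    (h : Comparison f g (MonoidalCategoryStruct.tensorUnit (ModuleCat.{u} A)) ⊥ 0)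
    (hP : ∀ n, Projective (P.X n)) (hP' : ∀ n, Projective (P'.X n)) (rs : List A)
    (hrs : RingTheory.Sequence.IsWeaklyRegular A rs) :
    Comparison f g (ModuleCat.of A (A ⧸ Ideal.ofList rs)) (Ideal.ofList rs) rs.length := by
  induction rs using List.reverseRecOn with
  | nil =>
    rw [Ideal.ofList_nil]
    exact h.of_natIso (torIso (Submodule.quotEquivOfEqBot (⊥ : Ideal A) rfl).toModuleIso)
  | append_singleton rs x ih =>
    rw [RingTheory.Sequence.isWeaklyRegular_append_iff,
      RingTheory.Sequence.isWeaklyRegular_singleton_iff] at hrs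
    have hx : IsSMulRegular (A ⧸ Ideal.ofList rs) x :=
      (LinearEquiv.isSMulRegular_congr (Submodule.quotEquivOfEq _ _ (by simp)) x).1 hrs.2
    have hJ : Ideal.ofList (rs ++ [x]) = Ideal.ofList rs ⊔ Ideal.span {x} := by
      rw [Ideal.ofList_append, Ideal.ofList_singleton]
    obtain ⟨π, w, hS⟩ := quotient_shortExact hx hJ
    have := (ih hrs.1).step hP hP' w hS
    rwa [← hJ, show rs.length + 1 = (rs ++ [x]).length by simp] at this

end Comparison

end TensorComplex

/-! ## Extension of scalars along an endomorphism -/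

/-- The ring `A`, as an algebra over `A` through `φ`. -/
def Twisted {A : Type u} [CommRing A] (_φ : A →+* A) : Type u := A

namespace Twisted

variable {A : Type u} [CommRing A] (φ : A →+* A)

instance : CommRing (Twisted φ) := inferInstanceAs (CommRing A)

instance : Algebra A (Twisted φ) := φ.toAlgebra

/-- The identity of `A`. -/
def of : A ≃+* Twisted φ := RingEquiv.refl A

theorem algebraMap_apply (a : A) : algebraMap A (Twisted φ) a = of φ (φ a) := rfl

theorem flat {φ : A →+* A} (hφ : φ.Flat) : Module.Flat A (Twisted φ) := hφ

end Twisted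

/-- The extension of scalars of `M` along `φ`. -/
def Pull {A : Type u} [CommRing A] (φ : A →+* A) (M : Type u) [AddCommGroup M] [Module A M] :
    Type u :=
  Twisted φ ⊗[A] M

namespace Pull

section

variable {A : Type u} [CommRing A] (φ : A →+* A) (M : Type u) [AddCommGroup M] [Module A M]

instance : AddCommGroup (Pull φ M) := inferInstanceAs (AddCommGroup (Twisted φ ⊗[A] M))

instance : Module (Twisted φ) (Pull φ M) := inferInstanceAs (Module (Twisted φ) (Twisted φ ⊗[A] M))

/-- The action is multiplication on the left factor. The tensor product over `A` already carries the
action through `φ`, hence the separate type. -/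
instance : Module A (Pull φ M) := Module.compHom _ (Twisted.of φ).toRingHom

variable {M}

/-- The element `1 ⊗ m`. -/
def one : M →ₛₗ[φ] Pull φ M where
  toFun m := (1 : Twisted φ) ⊗ₜ[A] m
  map_add' m n := TensorProduct.tmul_add _ _ _
  map_smul' a m := by
    change (1 : Twisted φ) ⊗ₜ[A] (a • m) = Twisted.of φ (φ a) • ((1 : Twisted φ) ⊗ₜ[A] m)
    rw [← TensorProduct.smul_tmul, TensorProduct.smul_tmul', Algebra.smul_def, smul_eq_mul,
      Twisted.algebraMap_apply]

theorem smul_one (a : A) (m : M) : a • one φ m = (Twisted.of φ a ⊗ₜ[A] m : Twisted φ ⊗[A] M) := by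
  change Twisted.of φ a • ((1 : Twisted φ) ⊗ₜ[A] m) = Twisted.of φ a ⊗ₜ[A] m
  rw [TensorProduct.smul_tmul', smul_eq_mul, mul_one]

variable {φ}

@[elab_as_elim]
theorem induction {p : Pull φ M → Prop} (zero : p 0) (smul_one : ∀ (a : A) m, p (a • one φ m))
    (add : ∀ z w, p z → p w → p (z + w)) (z : Pull φ M) : p z := by
  refine TensorProduct.induction_on (motive := p) z zero (fun a m => ?_) add
  have h := smul_one ((Twisted.of φ).symm a) m
  rw [Pull.smul_one, RingEquiv.apply_symm_apply] at h
  exact h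

variable {N : Type u} [AddCommGroup N] [Module A N]

theorem hom_ext {f g : Pull φ M →ₗ[A] N} (h : ∀ m, f (one φ m) = g (one φ m)) : f = g := by
  refine LinearMap.ext fun z => ?_
  induction z using induction with
  | zero => rw [map_zero, map_zero]
  | smul_one a m => rw [map_smul, map_smul, h]
  | add z w hz hw => rw [map_add, map_add, hz, hw]

/-- The linear map with prescribed values on the elements `1 ⊗ m`. -/
def lift (f : M →ₛₗ[φ] N) : Pull φ M →ₗ[A] N :=
  let g : Twisted φ ⊗[A] M →+ N := TensorProduct.liftAddHom
    { toFun := fun a =>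
        { toFun := fun m => (Twisted.of φ).symm a • f m
          map_zero' := by rw [map_zero, smul_zero]
          map_add' := fun _ _ => by rw [map_add, smul_add] }
      map_zero' := by
        ext m
        change (Twisted.of φ).symm 0 • f m = 0
        rw [map_zero, zero_smul]
      map_add' := fun a b => by
        ext m
        change (Twisted.of φ).symm (a + b) • f m =
          (Twisted.of φ).symm a • f m + (Twisted.of φ).symm b • f m
        rw [map_add, add_smul] } (fun r a m => by
      change (Twisted.of φ).symm (r • a) • f m = (Twisted.of φ).symm a • f (r • m)
      rw [Algebra.smul_def, map_smulₛₗ, ← mul_smul, mul_comm, map_mul,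
        Twisted.algebraMap_apply, RingEquiv.symm_apply_apply])
  have hg : ∀ (a : A) m, g (a • one φ m : Pull φ M) = a • f m := fun a m => by
    rw [smul_one]
    rfl
  { toFun := g
    map_add' := map_add g
    map_smul' := fun a z => by
      induction z using induction with
      | zero => exact (congrArg g (smul_zero a)).trans ((map_zero g).trans
          ((congrArg (a • ·) (map_zero g)).trans (smul_zero a)).symm)
      | smul_one b m =>
        rw [← mul_smul, hg, RingHom.id_apply, mul_smul]
        exact congrArg (a • ·) (hg b m).symm
      | add z w hz hw =>
        rw [smul_add]
        refine (map_add g _ _).trans ?_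
        rw [hz, hw, RingHom.id_apply, ← smul_add]
        exact congrArg (a • ·) (map_add g z w).symm }

theorem lift_one (f : M →ₛₗ[φ] N) (m : M) : lift f (one φ m) = f m :=
  _root_.one_smul A (f m)

/-- The linear map induced by a linear map. -/
def map (φ : A →+* A) (f : M →ₗ[A] N) : Pull φ M →ₗ[A] Pull φ N where
  toFun := LinearMap.lTensor (Twisted φ) f
  map_add' := map_add (LinearMap.lTensor (Twisted φ) f)
  map_smul' a z := (LinearMap.baseChange (Twisted φ) f).map_smul (Twisted.of φ a) z

theorem map_one (f : M →ₗ[A] N) (m : M) : map φ f (one φ m) = one φ (f m) := rfl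

theorem map_injective (hφ : φ.Flat) {f : M →ₗ[A] N} (hf : Function.Injective f) :
    Function.Injective (map φ f) :=
  have := Twisted.flat hφ
  Module.Flat.lTensor_preserves_injective_linearMap f hf

theorem projective [Module.Projective A M] : Module.Projective A (Pull φ M) := by
  have h : Module.Projective (Twisted φ) (Twisted φ ⊗[A] M) := inferInstance
  exact h

end

end Pull

namespace Frobenius

variable {A : Type u} [CommRing A]

/-- Extension of scalars along an endomorphism. -/
def pull (φ : A →+* A) : ModuleCat.{u} A ⥤ ModuleCat.{u} A where
  obj M := ModuleCat.of A (Pull φ M)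
  map f := ModuleCat.ofHom (Pull.map φ f.hom)
  map_id _ := ModuleCat.hom_ext (Pull.hom_ext fun _ => rfl)
  map_comp _ _ := ModuleCat.hom_ext (Pull.hom_ext fun _ => rfl)

instance (φ : A →+* A) : (pull φ).Additive where
  map_add {_ _ f g} := ModuleCat.hom_ext (Pull.hom_ext fun m => map_add (Pull.one φ) (f m) (g m))

theorem pull_preservesProjectiveObjects (φ : A →+* A) : (pull φ).PreservesProjectiveObjects where
  projective_obj {P} hP := by
    have : Module.Projective A P := (IsProjective.iff_projective (R := A) P).2 hP
    exact (IsProjective.iff_projective (R := A) (Pull φ P)).1 Pull.projective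

theorem pull_exact {φ : A →+* A} (hφ : φ.Flat) :
    Limits.PreservesFiniteLimits (pull φ) ∧ Limits.PreservesFiniteColimits (pull φ) :=
  ((Functor.exact_tfae (pull φ)).out 1 3).mp fun S h => by
    rw [ShortComplex.ShortExact.moduleCat_exact_iff_function_exact] at h ⊢
    have := Twisted.flat hφ
    exact Module.Flat.lTensor_exact (Twisted φ) h

section Residue

variable [IsLocalRing A]

/-- Tensoring with the residue field. -/
abbrev residueTensor (A : Type u) [CommRing A] [IsLocalRing A] :
    ModuleCat.{u} A ⥤ ModuleCat.{u} A :=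
  (MonoidalCategory.tensoringLeft (ModuleCat.{u} A)).obj (ModuleCat.of A (ResidueField A))

variable {φ : A →+* A}

/-- The reason why `k ⊗ φ*M` and `k ⊗ M` agree: `φ` is invisible on `k`. -/
theorem smul_residueField (hφ : ∀ a, residue A (φ a) = residue A a) (a : A)
    (c : ResidueField A) : φ a • c = a • c := by
  rw [Algebra.smul_def, Algebra.smul_def]
  exact congrArg (· * c) (hφ a)

section

variable {M : Type u} [AddCommGroup M] [Module A M]

/-- The map `1 ⊗ m ↦ 1 ⊗ m` from the extension of scalars of `M` to `k ⊗ M`. -/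
def toResidueTensor (hφ : ∀ a, residue A (φ a) = residue A a) :
    Pull φ M →ₗ[A] ResidueField A ⊗[A] M :=
  Pull.lift
    { toFun := fun m => (1 : ResidueField A) ⊗ₜ[A] m
      map_add' := fun m n => TensorProduct.tmul_add _ _ _
      map_smul' := fun a m => by
        rw [TensorProduct.smul_tmul', smul_residueField hφ, TensorProduct.smul_tmul] }

theorem toResidueTensor_one (hφ : ∀ a, residue A (φ a) = residue A a) (m : M) :
    toResidueTensor hφ (Pull.one φ m) = (1 : ResidueField A) ⊗ₜ[A] m :=
  Pull.lift_one _ m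

/-- The map `c ⊗ z ↦ c • z` from `k ⊗ N` to `k ⊗ M`, for `N` the extension of scalars of `M`. -/
def residueTensorPullTo (hφ : ∀ a, residue A (φ a) = residue A a) :
    (ResidueField A ⊗[A] Pull φ M) →ₗ[A] (ResidueField A ⊗[A] M) :=
  TensorProduct.lift (((LinearMap.lsmul (ResidueField A) (ResidueField A ⊗[A] M)).restrictScalars₁₂
    A A).compl₂ (toResidueTensor hφ))

theorem residueTensorPullTo_tmul_one (hφ : ∀ a, residue A (φ a) = residue A a)
    (c : ResidueField A) (m : M) :
    residueTensorPullTo hφ (c ⊗ₜ[A] Pull.one φ m) = c ⊗ₜ[A] m := by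
  change c • toResidueTensor hφ (Pull.one φ m) = c ⊗ₜ[A] m
  rw [toResidueTensor_one, TensorProduct.smul_tmul', smul_eq_mul, mul_one]

/-- The map `c ⊗ m ↦ c ⊗ (1 ⊗ m)` from `k ⊗ M` to `k ⊗ N`, for `N` the extension of scalars
of `M`. -/
def residueTensorPullFrom (hφ : ∀ a, residue A (φ a) = residue A a) :
    (ResidueField A ⊗[A] M) →ₗ[A] (ResidueField A ⊗[A] Pull φ M) :=
  TensorProduct.lift (LinearMap.mk₂ A
    (fun (c : ResidueField A) (m : M) => c ⊗ₜ[A] Pull.one φ m)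
    (fun _ _ _ => TensorProduct.add_tmul _ _ _) (fun _ _ _ => TensorProduct.smul_tmul' _ _ _)
    (fun _ _ _ => by rw [map_add, TensorProduct.tmul_add])
    (fun a c m => by
      rw [map_smulₛₗ, ← TensorProduct.smul_tmul, smul_residueField hφ, TensorProduct.smul_tmul']))

theorem residueTensorPullFrom_tmul (hφ : ∀ a, residue A (φ a) = residue A a)
    (c : ResidueField A) (m : M) :
    residueTensorPullFrom hφ (c ⊗ₜ[A] m) = c ⊗ₜ[A] Pull.one φ m := rfl

/-- The isomorphism between `k ⊗ N` and `k ⊗ M`, for `N` the extension of scalars of `M`. -/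
def residueTensorLinearEquiv (hφ : ∀ a, residue A (φ a) = residue A a) :
    (ResidueField A ⊗[A] Pull φ M) ≃ₗ[A] (ResidueField A ⊗[A] M) :=
  LinearEquiv.ofLinearMap (residueTensorPullTo hφ) (residueTensorPullFrom hφ)
    (TensorProduct.ext' fun c m => residueTensorPullTo_tmul_one hφ c m)
    (by
      refine TensorProduct.ext' fun c z => ?_
      induction z using Pull.induction generalizing c with
      | zero => rw [TensorProduct.tmul_zero, map_zero, map_zero]
      | smul_one a m =>
        rw [← TensorProduct.smul_tmul, LinearMap.comp_apply, residueTensorPullTo_tmul_one,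
          residueTensorPullFrom_tmul, LinearMap.id_apply]
      | add z w hz hw => rw [TensorProduct.tmul_add, map_add, map_add, hz, hw])

end

/-- Extension of scalars does not change the reduction modulo the maximal ideal. -/
def pullResidueTensorIso (hφ : ∀ a, residue A (φ a) = residue A a) :
    residueTensor A ≅ pull φ ⋙ residueTensor A :=
  NatIso.ofComponents (fun M => (residueTensorLinearEquiv (M := M) hφ).symm.toModuleIso)
    (fun _ => ModuleCat.hom_ext (TensorProduct.ext' fun _ _ => rfl))

end Residue

end Frobenius

/-! ## The socle of an extension of scalars -/

namespace Frobenius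

variable {A : Type u} [CommRing A] {φ : A →+* A}

/-- Extension of scalars of a projective resolution along a flat endomorphism. -/
def pullResolution (hφ : φ.Flat) {V : ModuleCat.{u} A} (P : ProjectiveResolution V) :
    ProjectiveResolution ((pull φ).obj V) :=
  have := (pull_exact hφ).1
  have := (pull_exact hφ).2
  have := pull_preservesProjectiveObjects φ
  (pull φ).mapProjectiveResolution P

variable [IsLocalRing A]

/-- Extension of scalars does not change the homology of the reduction of a complex. -/
def torPullIso (hφ : ∀ a, residue A (φ a) = residue A a) (i : ℕ) :
    TensorComplex.tor (ModuleCat.of A (ResidueField A)) i ≅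
      (pull φ).mapHomologicalComplex _ ⋙
        TensorComplex.tor (ModuleCat.of A (ResidueField A)) i :=
  Functor.isoWhiskerRight
    (NatIso.mapHomologicalComplex (pullResidueTensorIso hφ) (ComplexShape.down ℕ)) _

end Frobenius

section Socle

open Frobenius

variable {A : Type u} [CommRing A] [IsLocalRing A]

/-- The case `A/(rs) = k`: the map that `g` induces on the top `Tor` is its restriction to socles.
-/
theorem comparison_residueField {d : ℕ} {rs : List A} (hd : rs.length = d)
    (hrs : RingTheory.Sequence.IsWeaklyRegular A rs) (hm : Ideal.ofList rs = maximalIdeal A)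
    {V V' : ModuleCat.{u} A} {g : V ⟶ V'} (P : ProjectiveResolution V)
    (P' : ProjectiveResolution V') (f : P.complex ⟶ P'.complex)
    (hf : f ≫ P'.π = P.π ≫ (ChainComplex.single₀ (ModuleCat.{u} A)).map g) :
    TensorComplex.Comparison f g (ModuleCat.of A (ResidueField A)) (maximalIdeal A) d := by
  have h := (TensorComplex.Comparison.base P P' f hf).ofList P.projective P'.projective rs hrs
  rwa [hm, hd] at h

/-- The socle. -/
abbrev socle (A V : Type u) [CommRing A] [IsLocalRing A] [AddCommGroup V] [Module A V] :
    Submodule A V :=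
  Submodule.torsionBySet A V (maximalIdeal A)

theorem mem_socle {V : Type u} [AddCommGroup V] [Module A V] {v : V} :
    v ∈ socle A V ↔ ∀ a ∈ maximalIdeal A, a • v = 0 :=
  ⟨fun h a ha => (Submodule.mem_torsionBySet_iff _ _).1 h ⟨a, ha⟩,
    fun h => (Submodule.mem_torsionBySet_iff _ _).2 fun a => h a a.2⟩

/-- The top `Tor` of the residue field is the socle. -/
theorem nonempty_tor_equiv_socle {d : ℕ} {rs : List A} (hd : rs.length = d)
    (hrs : RingTheory.Sequence.IsWeaklyRegular A rs) (hm : Ideal.ofList rs = maximalIdeal A)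
    {V : ModuleCat.{u} A} (P : ProjectiveResolution V) :
    Nonempty ((TensorComplex.tor (ModuleCat.of A (ResidueField A)) d).obj P.complex ≃ₗ[A]
      socle A V) := by
  obtain ⟨ψ, -, hψ, -, hr, -⟩ := (comparison_residueField hd hrs hm P P (𝟙 _)
    (g := 𝟙 V) (by simp)).exists_hom
  have h : LinearMap.range ψ.hom = socle A V := by
    ext v
    rw [hr, mem_socle]
  exact ⟨(LinearEquiv.ofInjective ψ.hom hψ).trans (LinearEquiv.ofEq _ _ h)⟩

/-- Extension of scalars does not change the socle. -/
theorem nonempty_socle_pull_equiv {d : ℕ} {rs : List A} (hd : rs.length = d)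
    (hrs : RingTheory.Sequence.IsWeaklyRegular A rs) (hm : Ideal.ofList rs = maximalIdeal A)
    {φ : A →+* A} (hflat : φ.Flat) (hφ : ∀ a, residue A (φ a) = residue A a) (V : Type u)
    [AddCommGroup V] [Module A V] : Nonempty (socle A V ≃ₗ[A] socle A (Pull φ V)) := by
  -- Both socles are top `Tor` modules, computed from `k ⊗ P` and `k ⊗ φ*P`, which are isomorphic
  -- complexes.
  let P := projectiveResolution (ModuleCat.of A V)
  obtain ⟨e₁⟩ := nonempty_tor_equiv_socle hd hrs hm P
  obtain ⟨e₂⟩ := nonempty_tor_equiv_socle hd hrs hm (pullResolution hflat P)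
  exact ⟨e₁.symm.trans (((torPullIso hφ d).app P.complex).toLinearEquiv.trans e₂)⟩

end Socle

/-- Extension of scalars preserves torsion at the maximal ideal. -/
theorem Pull.exists_pow_smul_eq_zero {A : Type u} [CommRing A] [IsLocalRing A]
    [IsNoetherianRing A] {φ : A →+* A} {M : Type u} [AddCommGroup M] [Module A M]
    (hM : IsSmoothModule A M) {s : ℕ}
    (hs : maximalIdeal A ^ s ≤ (maximalIdeal A).map φ) (z : Pull φ M) :
    ∃ n, ∀ a ∈ maximalIdeal A ^ n, a • z = 0 := by
  induction z using Pull.induction with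
  | zero => exact ⟨0, fun a _ => smul_zero a⟩
  | smul_one a m =>
    obtain ⟨n, hn⟩ := hM.exists_pow_smul_eq_zero m
    -- `𝔪^(sn) ⊆ (φ(𝔪)A)^n = φ(𝔪^n)A`, and `φ(c)(1 ⊗ m) = 1 ⊗ cm = 0` for `c ∈ 𝔪^n`.
    refine ⟨s * n, fun b hb => ?_⟩
    have hb' : b ∈ (maximalIdeal A ^ n).map φ := by
      rw [Ideal.map_pow]
      rw [pow_mul] at hb
      exact Ideal.pow_right_mono hs n hb
    have h : (maximalIdeal A ^ n).map φ ≤ Ideal.torsionOf A _ (a • Pull.one φ m) := by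
      rw [Ideal.map_le_iff_le_comap]
      intro c hc
      rw [Ideal.mem_comap, Ideal.mem_torsionOf_iff, smul_comm, ← map_smulₛₗ, hn c hc, map_zero,
        smul_zero]
    exact h hb'
  | add z w hz hw =>
    obtain ⟨n, hn⟩ := hz
    obtain ⟨m, hm⟩ := hw
    refine ⟨n + m, fun a ha => ?_⟩
    rw [smul_add, hn a (Ideal.pow_le_pow_right (n.le_add_right m) ha),
      hm a (Ideal.pow_le_pow_right (m.le_add_left n) ha), add_zero]

/-! ## The linearization of `X` -/

namespace TwistedPoly

open Frobenius

variable {A : Type u} [CommRing A] {φ : A →+* A}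

/-- The action of `X`, as a semilinear map. -/
def xMap (M : ModuleCat.{u} (TwistedPoly φ)) : (under φ).obj M →ₛₗ[φ] (under φ).obj M where
  toFun m := show M from X φ • (show M from m)
  map_add' m n := smul_add (X φ) (show M from m) (show M from n)
  map_smul' a m := by
    change X φ • (C φ a • (show M from m)) = C φ (φ a) • (X φ • (show M from m))
    rw [← mul_smul, ← mul_smul, X_mul_C]

/-- The linearization `a ⊗ m ↦ a X m` of the action of `X`. -/
def linearization (φ : A →+* A) : under φ ⋙ pull φ ⟶ under φ where
  app M := ModuleCat.ofHom (X := Pull φ ((under φ).obj M)) (Y := (under φ).obj M)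
    (Pull.lift (xMap M))
  naturality M N f := ModuleCat.hom_ext (Pull.hom_ext fun m => by
    change Pull.lift (xMap N) (Pull.map φ ((under φ).map f).hom (Pull.one φ m)) =
      ((under φ).map f).hom (Pull.lift (xMap M) (Pull.one φ m))
    rw [Pull.map_one, Pull.lift_one, Pull.lift_one]
    exact (f.hom.map_smul (X φ) (show M from m)).symm)

theorem under_exact (φ : A →+* A) :
    Limits.PreservesFiniteLimits (under φ) ∧ Limits.PreservesFiniteColimits (under φ) :=
  ((Functor.exact_tfae (under φ)).out 1 3).mp fun S h => by
    rw [ShortComplex.ShortExact.moduleCat_exact_iff_function_exact] at h ⊢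
    exact h

/-- The resolution underlying a projective resolution. -/
def underResolution {M : ModuleCat.{u} (TwistedPoly φ)} (P : ProjectiveResolution M) :
    ProjectiveResolution ((under φ).obj M) :=
  have := (under_exact φ).1
  have := (under_exact φ).2
  have := under_preservesProjectiveObjects (φ := φ)
  (under φ).mapProjectiveResolution P

/-- Extension of scalars of the resolution underlying a projective resolution. -/
def underPullResolution (hflat : φ.Flat) {M : ModuleCat.{u} (TwistedPoly φ)}
    (P : ProjectiveResolution M) : ProjectiveResolution ((under φ ⋙ pull φ).obj M) :=
  have := (under_exact φ).1
  have := (under_exact φ).2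
  have := under_preservesProjectiveObjects (φ := φ)
  have := (pull_exact hflat).1
  have := (pull_exact hflat).2
  have := pull_preservesProjectiveObjects φ
  (under φ ⋙ pull φ).mapProjectiveResolution P

theorem mapHomologicalComplex_single_comm {C D : Type*} [Category* C] [Category* D] [Abelian C]
    [Abelian D] {F G : C ⥤ D} [F.Additive] [G.Additive] (α : F ⟶ G) (Z : C) :
    (NatTrans.mapHomologicalComplex α (ComplexShape.down ℕ)).app
        ((ChainComplex.single₀ C).obj Z) ≫
      (HomologicalComplex.singleMapHomologicalComplex G (ComplexShape.down ℕ) 0).hom.app Z =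
    (HomologicalComplex.singleMapHomologicalComplex F (ComplexShape.down ℕ) 0).hom.app Z ≫
      (ChainComplex.single₀ D).map (α.app Z) := by
  refine HomologicalComplex.to_single_hom_ext ?_
  rw [HomologicalComplex.comp_f, HomologicalComplex.comp_f,
    HomologicalComplex.singleMapHomologicalComplex_hom_app_self,
    HomologicalComplex.singleMapHomologicalComplex_hom_app_self,
    HomologicalComplex.single_map_f_self]
  change α.app (((HomologicalComplex.single C (ComplexShape.down ℕ) 0).obj Z).X 0) ≫
    G.map (HomologicalComplex.singleObjXSelf (ComplexShape.down ℕ) 0 Z).hom ≫ _ =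
      (F.map (HomologicalComplex.singleObjXSelf (ComplexShape.down ℕ) 0 Z).hom ≫ _) ≫ _
  rw [Category.assoc, Iso.inv_hom_id_assoc, ← α.naturality_assoc]

/-- Applied to a resolution, a natural transformation is a chain map lifting its component at the
resolved object. This is the compatibility that `comparison_residueField` requires. -/
theorem mapProjectiveResolution_comm {C D : Type*} [Category* C] [Category* D] [Abelian C]
    [Abelian D] {F G : C ⥤ D} [F.Additive] [G.Additive] [F.PreservesProjectiveObjects]
    [G.PreservesProjectiveObjects] [F.PreservesHomology] [G.PreservesHomology] (α : F ⟶ G) {Z : C}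
    (P : ProjectiveResolution Z) :
    (NatTrans.mapHomologicalComplex α (ComplexShape.down ℕ)).app P.complex ≫
        (G.mapProjectiveResolution P).π =
      (F.mapProjectiveResolution P).π ≫ (ChainComplex.single₀ D).map (α.app Z) := by
  have h := (NatTrans.mapHomologicalComplex α (ComplexShape.down ℕ)).naturality P.π
  have h1 := mapHomologicalComplex_single_comm α Z
  dsimp only [Functor.mapProjectiveResolution]
  refine (Category.assoc _ _ _).symm.trans ?_
  refine (congrArg (· ≫ _) h.symm).trans ?_
  refine (Category.assoc _ _ _).trans ?_
  refine (congrArg (_ ≫ ·) h1).trans ?_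
  exact (Category.assoc _ _ _).symm

/-- The linearization of `X` on a projective resolution. -/
def linearizationComplex (hflat : φ.Flat) {M : ModuleCat.{u} (TwistedPoly φ)}
    (P : ProjectiveResolution M) :
    (underPullResolution hflat P).complex ⟶ (underResolution P).complex :=
  (NatTrans.mapHomologicalComplex (linearization φ) (ComplexShape.down ℕ)).app P.complex

theorem linearizationComplex_comm (hflat : φ.Flat) {M : ModuleCat.{u} (TwistedPoly φ)}
    (P : ProjectiveResolution M) :
    linearizationComplex hflat P ≫ (underResolution P).π =
      (underPullResolution hflat P).π ≫
        (ChainComplex.single₀ (ModuleCat.{u} A)).map ((linearization φ).app M) :=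
  have := (under_exact φ).1
  have := (under_exact φ).2
  have := under_preservesProjectiveObjects (φ := φ)
  have := (pull_exact hflat).1
  have := (pull_exact hflat).2
  have := pull_preservesProjectiveObjects φ
  mapProjectiveResolution_comm (linearization φ) P

variable [IsLocalRing A]

theorem mono_homologyMap_mapHomologicalComplex {C D : Type*} [Category* C] [Category* D] [Abelian C]
    [Abelian D] (F : C ⥤ D) [F.Additive] [F.PreservesHomology] [F.PreservesMonomorphisms]
    {K L : ChainComplex C ℕ} (f : K ⟶ L) (i : ℕ) [Mono (HomologicalComplex.homologyMap f i)] :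
    Mono (HomologicalComplex.homologyMap
      ((F.mapHomologicalComplex (ComplexShape.down ℕ)).map f) i) := by
  have h := ShortComplex.mapHomologyIso_hom_naturality (F := F)
    ((HomologicalComplex.shortComplexFunctor _ _ i).map f)
  have h1 : Mono (F.map (HomologicalComplex.homologyMap f i)) := inferInstance
  have h2 := @mono_comp _ _ _ _ _ ((K.sc i).mapHomologyIso F).hom inferInstance
    (F.map (HomologicalComplex.homologyMap f i)) h1
  exact @mono_of_mono_fac _ _ _ _ _ _ _ _ h2 h

section

variable {φ : A →+* A} [IsLocalHom φ] (hφ : ResidueField.map φ = RingHom.id (ResidueField A))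

theorem mono_of_comm_of_isIso {C D : Type*} [Category* C] [Category* D] (H : C ⥤ D)
    {K L N : C} {x : K ⟶ K} {e : K ⟶ N} {p : N ⟶ L} {t : L ⟶ N}
    (h : x ≫ e = e ≫ p ≫ t) (hx : Mono (H.map x)) (he : IsIso e) (hp : IsIso p) :
    Mono (H.map t) := by
  have h1 : t = inv p ≫ inv e ≫ x ≫ e := by
    rw [h, IsIso.inv_hom_id_assoc, IsIso.inv_hom_id_assoc]
  rw [h1, H.map_comp, H.map_comp, H.map_comp]
  infer_instance

/-- On the reduction of a complex, multiplication by `X` is induced by its linearization. -/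
theorem reductionIso_comm (M : ModuleCat.{u} (TwistedPoly φ)) :
    (overBase A).map ((Polynomial.X : (ResidueField A)[X]) • 𝟙 ((reduction hφ).obj M)) ≫
        (reductionIso hφ).hom.app M =
      (reductionIso hφ).hom.app M ≫ (pullResidueTensorIso (residue_apply hφ)).hom.app
        ((under φ).obj M) ≫ (residueTensor A).map ((linearization φ).app M) := by
  have h : xOp hφ M = ((LinearMap.lTensor (ResidueField A) (Pull.lift (xMap M)) ∘ₗ
      residueTensorPullFrom (residue_apply hφ)) :
      (ResidueField A ⊗[A] (under φ).obj M) →ₗ[A] (ResidueField A ⊗[A] (under φ).obj M)) := by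
    refine TensorProduct.ext' fun c m => ?_
    rw [LinearMap.comp_apply, residueTensorPullFrom_tmul, LinearMap.lTensor_tmul]
    refine (xOp_tmul hφ M c m).trans ?_
    exact congrArg (fun n => c ⊗ₜ[A] n) (Pull.lift_one (xMap M) m).symm
  refine ModuleCat.hom_ext (LinearMap.ext fun z => ?_)
  have h1 : (Module.AEval'.of (xOp hφ M)).symm ((Polynomial.X : (ResidueField A)[X]) •
      (show Module.AEval' (xOp hφ M) from z)) =
        xOp hφ M ((Module.AEval'.of (xOp hφ M)).symm (show Module.AEval' (xOp hφ M) from z)) := by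
    rw [LinearEquiv.symm_apply_eq, ← Module.AEval'.X_smul_of, LinearEquiv.apply_symm_apply]
  refine Eq.trans ?_ (h1.trans (LinearMap.congr_fun h _))
  rfl

/-- On `k ⊗ P` the operator `X` factors as the isomorphism `k ⊗ P ≅ k ⊗ φ*P` followed by the
linearization, so in homology one is injective when the other is. -/
theorem mono_tor_linearization (hflat : φ.Flat) (d : ℕ) {M : ModuleCat.{u} (TwistedPoly φ)}
    (P : ProjectiveResolution M)
    (hX : Function.Injective
      fun t : (torFunctor hφ d).obj M => (Polynomial.X : (ResidueField A)[X]) • t) :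
    Mono ((TensorComplex.tor (ModuleCat.of A (ResidueField A)) d).map
      (linearizationComplex hflat P)) := by
  let K := ((reduction hφ).mapHomologicalComplex (ComplexShape.down ℕ)).obj P.complex
  let x : K ⟶ K := (Polynomial.X : (ResidueField A)[X]) • 𝟙 K
  have hx : HomologicalComplex.homologyMap x d =
      (Polynomial.X : (ResidueField A)[X]) • 𝟙 (K.homology d) := by
    refine (ShortComplex.homologyMap_smul (𝟙 (K.sc d)) _).trans ?_
    rw [ShortComplex.homologyMap_id]
    rfl
  have hx' : Mono (HomologicalComplex.homologyMap x d) := by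
    rw [hx, ModuleCat.mono_iff_injective]
    let e₀ := (P.isoLeftDerivedObj (reduction hφ) d).toLinearEquiv
    intro a b hab
    refine e₀.symm.injective (hX ?_)
    have hab' : (Polynomial.X : (ResidueField A)[X]) • a =
      (Polynomial.X : (ResidueField A)[X]) • b := hab
    exact (e₀.symm.map_smul _ a).symm.trans ((congrArg e₀.symm hab').trans (e₀.symm.map_smul _ b))
  have h1 := mono_homologyMap_mapHomologicalComplex (overBase A) x d
  let e : ((overBase A).mapHomologicalComplex (ComplexShape.down ℕ)).obj K ≅
      (TensorComplex.tensor (ModuleCat.of A (ResidueField A))).obj (underResolution P).complex :=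
    HomologicalComplex.Hom.isoOfComponents (fun n => (reductionIso hφ).app (P.complex.X n))
      (fun n m _ => ((reductionIso hφ).hom.naturality (P.complex.d n m)).symm)
  let t := (TensorComplex.tensor (ModuleCat.of A (ResidueField A))).map
      (linearizationComplex hflat P)
  let p := (NatTrans.mapHomologicalComplex (pullResidueTensorIso (residue_apply hφ)).hom
    (ComplexShape.down ℕ)).app (underResolution P).complex
  have hc : ((overBase A).mapHomologicalComplex (ComplexShape.down ℕ)).map x ≫ e.hom =
      e.hom ≫ p ≫ t := by
    ext n : 1
    exact reductionIso_comm hφ (P.complex.X n)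
  have hp : IsIso p := ((NatIso.mapHomologicalComplex (pullResidueTensorIso (residue_apply hφ))
    (ComplexShape.down ℕ)).app (underResolution P).complex).isIso_hom
  exact mono_of_comm_of_isIso (HomologicalComplex.homologyFunctor _ _ d) hc h1 e.isIso_hom hp

/-- If `X` is injective on the top `Tor`, its linearization is injective. -/
theorem lift_xMap_injective [IsNoetherianRing A] (hflat : φ.Flat) {d : ℕ} {rs : List A}
    (hd : rs.length = d)
    (hrs : RingTheory.Sequence.IsWeaklyRegular A rs) (hm : Ideal.ofList rs = maximalIdeal A)
    {s : ℕ} (hs : maximalIdeal A ^ s ≤ (maximalIdeal A).map φ) (M : ModuleCat.{u} (TwistedPoly φ))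
    (hM : IsSmoothModule A ((under φ).obj M))
    (hX : Function.Injective
      fun t : (torFunctor hφ d).obj M => (Polynomial.X : (ResidueField A)[X]) • t) :
    Function.Injective (Pull.lift (xMap M)) := by
  let P := projectiveResolution M
  obtain ⟨ψ, ψ', hψ, hψ', hr, -, hc⟩ := (comparison_residueField hd hrs hm
    (underPullResolution hflat P) (underResolution P) (linearizationComplex hflat P)
    (linearizationComplex_comm hflat P)).exists_hom
  have ht := (ModuleCat.mono_iff_injective _).1 (mono_tor_linearization hφ hflat d P hX)
  rw [injective_iff_map_eq_zero]
  intro v hv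
  by_contra hv0
  obtain ⟨n, hn⟩ := Pull.exists_pow_smul_eq_zero hM hs v
  -- A nonzero kernel element has a nonzero multiple in the socle of `φ*M`; this comes from a class
  -- `c` in the top `Tor`, on which the linearization is injective.
  obtain ⟨a, ha, hsoc⟩ := exists_ne_zero_smul_eq_zero hv0 hn
  obtain ⟨c, hc'⟩ := (hr (a • v)).2 hsoc
  have h1 : ψ' ((TensorComplex.tor (ModuleCat.of A (ResidueField A)) d).map
      (linearizationComplex hflat P) c) = 0 := by
    refine (congrArg (fun z => z.hom c) hc).symm.trans ?_
    refine (congrArg (Pull.lift (xMap M)) hc').trans ?_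
    rw [map_smul, hv, smul_zero]
  have h2 : c = 0 := ht (hψ' (h1.trans (by rw [map_zero, map_zero])))
  rw [h2, map_zero] at hc'
  exact ha hc'.symm

end

end TwistedPoly

/-! ## Modules with an injective linearized semilinear operator -/

namespace SemilinearOperator

variable {A V : Type u} [CommRing A] [AddCommGroup V] [Module A V] {φ : A →+* A} (F : V →ₛₗ[φ] V)

/-- The submodule generated by the image of a submodule. -/
def shift (W : Submodule A V) : Submodule A V := Submodule.span A (F '' W)

/-- As a left adjoint, `shift F` is monotone and commutes with suprema. -/
theorem gc_shift : GaloisConnection (shift F) (Submodule.comap F) := fun W U => by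
  rw [shift, Submodule.span_le, Set.image_subset_iff]
  rfl

theorem shift_mono : Monotone (shift F) := (gc_shift F).monotone_l

theorem shift_iterate_mono (n : ℕ) : Monotone (shift F)^[n] := (shift_mono F).iterate n

theorem shift_iterate_iSup (n : ℕ) {ι : Type*} (W : ι → Submodule A V) :
    (shift F)^[n] (⨆ i, W i) = ⨆ i, (shift F)^[n] (W i) := by
  induction n with
  | zero => rfl
  | succ n ih =>
    rw [Function.iterate_succ_apply', ih, (gc_shift F).l_iSup]
    exact iSup_congr fun i => (Function.iterate_succ_apply' (shift F) n (W i)).symm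

theorem shift_fg {W : Submodule A V} (hW : W.FG) : (shift F W).FG := by
  classical
  obtain ⟨s, rfl⟩ := hW
  refine ⟨s.image F, le_antisymm (Submodule.span_mono ?_) ((gc_shift F).l_le ?_)⟩
  · rw [Finset.coe_image]
    exact Set.image_mono Submodule.subset_span
  · rw [Submodule.span_le]
    exact fun v hv => Submodule.subset_span (Finset.mem_coe.2 (Finset.mem_image_of_mem F hv))

theorem shift_iterate_fg {W : Submodule A V} (hW : W.FG) (n : ℕ) : ((shift F)^[n] W).FG := by
  induction n with
  | zero => exact hW
  | succ n ih =>
    rw [Function.iterate_succ_apply']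
    exact shift_fg F ih

/-- If the linearization of `F` is injective, `shift F W` is the extension of scalars of `W`. -/
theorem nonempty_pull_equiv_shift (hflat : φ.Flat) (hF : Function.Injective (Pull.lift F))
    (W : Submodule A V) : Nonempty (Pull φ W ≃ₗ[A] shift F W) := by
  let g : Pull φ W →ₗ[A] V := Pull.lift F ∘ₗ Pull.map φ W.subtype
  have hg1 : ∀ w : W, g (Pull.one φ w) = F w := fun w => Pull.lift_one F (w : V)
  have hg : Function.Injective g :=
    hF.comp (Pull.map_injective hflat W.injective_subtype)
  have hr : LinearMap.range g = shift F W := by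
    refine le_antisymm ?_ ((gc_shift F).l_le fun w hw => ⟨Pull.one φ ⟨w, hw⟩, hg1 ⟨w, hw⟩⟩)
    rintro _ ⟨z, rfl⟩
    induction z using Pull.induction with
    | zero => rw [map_zero]; exact zero_mem _
    | smul_one a m =>
      rw [map_smul, hg1]
      exact Submodule.smul_mem _ _ (Submodule.subset_span (Set.mem_image_of_mem F m.2))
    | add z w hz hw => rw [map_add]; exact add_mem hz hw
  exact ⟨(LinearEquiv.ofInjective g hg).trans (LinearEquiv.ofEq _ _ hr)⟩

theorem eq_of_le_of_length_eq {U W : Submodule A V} (h : U ≤ W) [IsArtinian A W] [IsNoetherian A W]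
    (hl : Module.length A U = Module.length A W) : U = W := by
  by_contra hne
  have h1 : Submodule.comap W.subtype U ≠ ⊤ := fun h2 =>
    hne (le_antisymm h (Submodule.comap_subtype_eq_top.1 h2))
  have h2 := Submodule.length_lt h1
  rw [(Submodule.comapSubtypeEquivOfLe h).length_eq, hl] at h2
  exact lt_irrefl _ h2

/-- A finitely generated submodule contained in the shift of the union of its iterated shifts
generates the same union as a finitely generated submodule contained in its shift. -/
theorem exists_fg_le_shift {U : Submodule A V} (hU : U.FG)
    (hle : U ≤ shift F (⨆ n, (shift F)^[n] U)) :
    ∃ W : Submodule A V, W.FG ∧ U ≤ W ∧ W ≤ shift F W := by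
  rw [(gc_shift F).l_iSup] at hle
  -- Being finitely generated, `U` is a compact element, so it lies in the sum of `shift^(i+1) U`
  -- for `i < n`. The sum of `shift^i U` for `i ≤ n` is then contained in its own shift.
  obtain ⟨s, hs⟩ := CompleteLattice.IsCompactElement.exists_finset_of_le_iSup _
    ((Submodule.fg_iff_compact U).1 hU) _ hle
  obtain ⟨n, hn⟩ := s.exists_nat_subset_range
  have hmem : ∀ i < n + 1, (shift F)^[i] U ≤ ⨆ i ∈ Finset.range (n + 1), (shift F)^[i] U :=
    fun i hi => le_iSup₂_of_le i (Finset.mem_range.2 hi) le_rfl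
  refine ⟨⨆ i ∈ Finset.range (n + 1), (shift F)^[i] U,
    Submodule.fg_biSup _ _ fun i _ => shift_iterate_fg F hU i, hmem 0 n.succ_pos,
    iSup₂_le fun i hi => ?_⟩
  rcases i with _ | i
  · refine hs.trans (iSup₂_le fun j hj => shift_mono F (hmem j ?_))
    exact (Finset.mem_range.1 (hn hj)).trans n.lt_succ_self
  · rw [Function.iterate_succ_apply']
    exact shift_mono F (hmem i (by have := Finset.mem_range.1 hi; omega))

variable [IsLocalRing A]

theorem nonempty_socle_equiv {V' : Type u} [AddCommGroup V'] [Module A V'] (e : V ≃ₗ[A] V') :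
    Nonempty (socle A V ≃ₗ[A] socle A V') := by
  have h : (socle A V).map (e : V →ₗ[A] V') = socle A V' := by
    ext v
    rw [Submodule.mem_map_equiv, mem_socle, mem_socle]
    refine forall₂_congr fun a _ => ?_
    rw [← map_smul, LinearEquiv.map_eq_zero_iff]
  exact ⟨(e.submoduleMap _).trans (LinearEquiv.ofEq _ _ h)⟩

theorem nonempty_socle_equiv_inf (W : Submodule A V) :
    Nonempty (socle A W ≃ₗ[A] (socle A V ⊓ W : Submodule A V)) := by
  have h : (socle A W).map W.subtype = socle A V ⊓ W := by
    ext v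
    rw [Submodule.mem_map, Submodule.mem_inf, mem_socle]
    constructor
    · rintro ⟨w, hw, rfl⟩
      rw [mem_socle] at hw
      exact ⟨fun a ha => congrArg Subtype.val (hw a ha), w.2⟩
    · rintro ⟨hv, hw⟩
      exact ⟨⟨v, hw⟩, mem_socle.2 fun a ha => Subtype.ext (hv a ha), rfl⟩
  exact ⟨(Submodule.equivMapOfInjective W.subtype W.injective_subtype _).trans
    (LinearEquiv.ofEq _ _ h)⟩

/-- `shift F W` is a copy of `φ*W`, whose socle is isomorphic to that of `W`. The isomorphism need
not respect the embeddings in `V`, so only lengths are compared. -/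
theorem length_socle_inf_shift (hflat : φ.Flat) (hF : Function.Injective (Pull.lift F))
    (hsoc : ∀ W : Submodule A V, Nonempty (socle A W ≃ₗ[A] socle A (Pull φ W)))
    (W : Submodule A V) :
    Module.length A (socle A V ⊓ shift F W : Submodule A V) =
      Module.length A (socle A V ⊓ W : Submodule A V) := by
  obtain ⟨e₁⟩ := nonempty_pull_equiv_shift F hflat hF W
  obtain ⟨e₂⟩ := nonempty_socle_equiv e₁
  obtain ⟨e₃⟩ := hsoc W
  obtain ⟨e₄⟩ := nonempty_socle_equiv_inf W
  obtain ⟨e₅⟩ := nonempty_socle_equiv_inf (shift F W)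
  exact (e₄.symm.trans (e₃.trans (e₂.trans e₅))).length_eq.symm

/-- If `W` is contained in `shift F W`, the union of the iterated shifts of `W` has the socle
of `W`. -/
theorem socle_inf_iSup_shift_le [IsNoetherianRing A] (hflat : φ.Flat)
    (hF : Function.Injective (Pull.lift F))
    (hsoc : ∀ W : Submodule A V, Nonempty (socle A W ≃ₗ[A] socle A (Pull φ W)))
    (hV : IsSmoothModule A V) {W : Submodule A V} (hW : W.FG) (hle : W ≤ shift F W) :
    socle A V ⊓ ⨆ n, (shift F)^[n] W ≤ W := by
  have hmono : Monotone fun n => (shift F)^[n] W :=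
    (shift_mono F).monotone_iterate_of_le_map hle
  have hlen : ∀ n, Module.length A (socle A V ⊓ (shift F)^[n] W : Submodule A V) =
      Module.length A (socle A V ⊓ W : Submodule A V) := fun n => by
    induction n with
    | zero => rfl
    | succ n ih => rw [Function.iterate_succ_apply', length_socle_inf_shift F hflat hF hsoc, ih]
  -- By smoothness these socles have finite length, so inclusion and equal length give equality.
  have heq : ∀ n, socle A V ⊓ W = socle A V ⊓ (shift F)^[n] W := fun n => by
    have hfg := shift_iterate_fg F hW n
    have : Module.Finite A ((shift F)^[n] W) := Module.Finite.iff_fg.2 hfg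
    have : IsArtinian A ((shift F)^[n] W) := hV _ hfg
    have : IsArtinian A (socle A V ⊓ (shift F)^[n] W : Submodule A V) :=
      isArtinian_of_le inf_le_right
    have : IsNoetherian A (socle A V ⊓ (shift F)^[n] W : Submodule A V) :=
      isNoetherian_of_le inf_le_right
    exact eq_of_le_of_length_eq (inf_le_inf_left _ (hmono (Nat.zero_le n))) (hlen n).symm
  rintro v ⟨hv, hv'⟩
  obtain ⟨n, hn⟩ := (Submodule.mem_iSup_of_directed _ hmono.directed_le).1 hv'
  exact ((heq n).symm ▸ (⟨hv, hn⟩ : v ∈ socle A V ⊓ (shift F)^[n] W) : v ∈ socle A V ⊓ W).2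

/-- Generation gives `V = W + shift V`, so by iteration `V/shift^n V` is finitely generated over
`A`. As `W` fills it modulo `𝔪`, Nakayama shows that `W` fills it. -/
theorem sup_shift_iterate_top [IsNoetherianRing A] {W : Submodule A V} (hW : W.FG)
    (hgen : ∀ U : Submodule A V, W ≤ U → shift F U ≤ U → U = ⊤)
    (hm : W ⊔ maximalIdeal A • ⊤ = ⊤) (n : ℕ) : W ⊔ (shift F)^[n] ⊤ = ⊤ := by
  have h1 : W ⊔ shift F ⊤ = ⊤ :=
    hgen _ le_sup_left ((shift_mono F le_top).trans le_sup_right)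
  have h2 : ∃ U : Submodule A V, U.FG ∧ U ⊔ (shift F)^[n] ⊤ = ⊤ := by
    induction n with
    | zero => exact ⟨⊥, Submodule.fg_bot, sup_top_eq _⟩
    | succ n ih =>
      obtain ⟨U, hU, hUn⟩ := ih
      refine ⟨W ⊔ shift F U, hW.sup (shift_fg F hU), ?_⟩
      rw [Function.iterate_succ_apply', sup_assoc, ← (gc_shift F).l_sup, hUn, h1]
  obtain ⟨U, hU, hUn⟩ := h2
  generalize (shift F)^[n] (⊤ : Submodule A V) = T at hUn ⊢
  have h3 : (maximalIdeal A • ⊤ : Submodule A V) ≤ W ⊔ T ⊔ maximalIdeal A • U := by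
    rw [← hUn, Submodule.smul_sup]
    have h4 : maximalIdeal A • T ≤ T :=
      Submodule.smul_le.2 fun a _ v hv => Submodule.smul_mem T a hv
    exact sup_le le_sup_right (h4.trans (le_sup_right.trans le_sup_left))
  have h5 : U ≤ W ⊔ T := by
    refine Submodule.le_of_le_smul_of_le_jacobson_bot hU (maximalIdeal_le_jacobson ⊥) ?_
    have h6 : U ≤ W ⊔ maximalIdeal A • ⊤ := le_top.trans hm.symm.le
    exact h6.trans (sup_le (le_sup_left.trans le_sup_left) h3)
  have h7 := sup_le h5 (le_sup_right : T ≤ W ⊔ T)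
  rw [hUn] at h7
  exact top_le_iff.1 h7

/-- A smooth module over which the linearization of a semilinear operator is injective, which is
generated by a finitely generated submodule and finitely generated modulo the maximal ideal, has
a finitely generated socle. -/
theorem socle_fg [IsNoetherianRing A] (hflat : φ.Flat) (hF : Function.Injective (Pull.lift F))
    (hsoc : ∀ W : Submodule A V, Nonempty (socle A W ≃ₗ[A] socle A (Pull φ W)))
    (hV : IsSmoothModule A V) {W : Submodule A V} (hW : W.FG)
    (hgen : ∀ U : Submodule A V, W ≤ U → shift F U ≤ U → U = ⊤)
    (hm : W ⊔ maximalIdeal A • ⊤ = ⊤) : (socle A V).FG := by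
  have htop := sup_shift_iterate_top F hW hgen hm
  have hanti : Antitone fun n => (shift F)^[n] ⊤ :=
    (shift_mono F).antitone_iterate_of_map_le le_top
  have : IsArtinian A W := hV W hW
  let f : ℕ →o (Submodule A W)ᵒᵈ :=
    ⟨fun n => OrderDual.toDual (((shift F)^[n] ⊤).comap W.subtype),
      fun i j hij => Submodule.comap_mono (hanti hij)⟩
  obtain ⟨n, hn⟩ := IsArtinian.monotone_stabilizes f
  have hn1 : W ⊓ (shift F)^[n] ⊤ ≤ (shift F)^[n + 1] ⊤ := by
    rintro w ⟨hw, hw'⟩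
    have h : ((shift F)^[n] ⊤).comap W.subtype = ((shift F)^[n + 1] ⊤).comap W.subtype :=
      hn (n + 1) n.le_succ
    exact (h ▸ (hw' : (⟨w, hw⟩ : W) ∈ ((shift F)^[n] ⊤).comap W.subtype) :
      (⟨w, hw⟩ : W) ∈ ((shift F)^[n + 1] ⊤).comap W.subtype)
  -- The modular law turns `V = W + shift^(n+1) V` and the stabilization inside `W` into
  -- stabilization of `shift^n V` itself.
  have hstab : (shift F)^[n] ⊤ ≤ shift F ((shift F)^[n] ⊤) := by
    rw [← Function.iterate_succ_apply' (shift F)]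
    calc (shift F)^[n] ⊤ = ((shift F)^[n + 1] ⊤ ⊔ W) ⊓ (shift F)^[n] ⊤ := by
          rw [sup_comm, htop, top_inf_eq]
      _ = (shift F)^[n + 1] ⊤ ⊔ W ⊓ (shift F)^[n] ⊤ := sup_inf_assoc_of_le W (hanti n.le_succ)
      _ ≤ (shift F)^[n + 1] ⊤ := sup_le le_rfl hn1
  have hiSup : ⨆ i, (shift F)^[i] W = ⊤ :=
    hgen _ (le_iSup (fun i => (shift F)^[i] W) 0) (by
      rw [(gc_shift F).l_iSup]
      refine iSup_le fun i => ?_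
      rw [← Function.iterate_succ_apply' (shift F)]
      exact le_iSup (fun i => (shift F)^[i] W) (i + 1))
  have hL : (shift F)^[n] ⊤ = ⨆ i, (shift F)^[i] ((shift F)^[n] W) := by
    rw [← hiSup, shift_iterate_iSup]
    exact iSup_congr fun i => ((Function.Commute.refl (shift F)).iterate_iterate n i).eq W
  -- `L = shift^n V` is the union of the shifts of `shift^n W` and lies in `shift L`, which allows
  -- enlarging `shift^n W` to a finitely generated `U ⊆ shift U`.
  obtain ⟨U, hU, hWU, hle⟩ := exists_fg_le_shift F (shift_iterate_fg F hW n) (by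
    rw [← hL]
    exact (shift_iterate_mono F n le_top).trans hstab)
  have hLU : (shift F)^[n] ⊤ ≤ ⨆ i, (shift F)^[i] U := by
    rw [hL]
    exact iSup_mono fun i => shift_iterate_mono F i hWU
  have hsocL : (socle A V ⊓ (shift F)^[n] ⊤).FG := by
    have : IsNoetherian A U := isNoetherian_of_fg_of_noetherian U hU
    exact Submodule.FG.of_le hU
      ((inf_le_inf_left _ hLU).trans (socle_inf_iSup_shift_le F hflat hF hsoc hV hU hle))
  have hfin : Module.Finite A (V ⧸ (shift F)^[n] ⊤) := by
    refine Module.finite_def.2 ?_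
    have h : W.map ((shift F)^[n] ⊤).mkQ = ⊤ := by
      rw [Submodule.map_mkQ_eq_top, sup_comm, htop]
    rw [← h]
    exact hW.map _
  -- The socle of `V` is an extension of a submodule of the Noetherian module `V/L` by the socle of
  -- `L`.
  refine Submodule.fg_of_fg_map_of_fg_inf_ker ((shift F)^[n] ⊤).mkQ (IsNoetherian.noetherian _) ?_
  rwa [Submodule.ker_mkQ]

end SemilinearOperator

/-! ## Torsion-free top `Tor` -/

/-- A smooth module with trivial socle is trivial. -/
theorem IsSmoothModule.subsingleton_of_subsingleton_socle {A V : Type u} [CommRing A]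
    [IsLocalRing A] [IsNoetherianRing A] [AddCommGroup V] [Module A V] (hV : IsSmoothModule A V)
    [Subsingleton (socle A V)] : Subsingleton V := by
  rw [subsingleton_iff_forall_eq 0]
  intro v
  by_contra hv
  obtain ⟨n, hn⟩ := hV.exists_pow_smul_eq_zero v
  obtain ⟨a, ha, ha'⟩ := exists_ne_zero_smul_eq_zero hv hn
  exact ha (congrArg Subtype.val
    (Subsingleton.elim (⟨a • v, mem_socle.2 ha'⟩ : socle A V) 0))

theorem IsSmoothModule.of_injective {A V V' : Type u} [CommRing A] [AddCommGroup V] [Module A V]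
    [AddCommGroup V'] [Module A V'] (hV : IsSmoothModule A V') (f : V →ₗ[A] V')
    (hf : Function.Injective f) : IsSmoothModule A V := fun P hP =>
  have := hV (P.map f) (hP.map f)
  isArtinian_of_linearEquiv (Submodule.equivMapOfInjective f hf P).symm

namespace TwistedPoly

variable {A : Type u} [CommRing A] {φ : A →+* A}

-- The factor `X` is on the right because `(fX)m = f(Xm)`: stability under `X` is used first, then
-- the hypothesis on `f`.
@[elab_as_elim]
theorem induction_mul_X {p : TwistedPoly φ → Prop} (f : TwistedPoly φ) (zero : p 0)
    (const : ∀ a, p (C φ a)) (mul_X : ∀ f, p f → p (f * X φ)) (add : ∀ f g, p f → p g → p (f + g)) :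
    p f := by
  let _ := powAction φ
  refine SkewMonoidAlgebra.induction_on (p := p) f zero (fun g a => ?_) add
  induction g using Multiplicative.rec with | _ n
  induction n with
  | zero => exact const a
  | succ n ih =>
    have h : (SkewMonoidAlgebra.single (Multiplicative.ofAdd n) a :
          SkewMonoidAlgebra A (Multiplicative ℕ)) *
        SkewMonoidAlgebra.single (Multiplicative.ofAdd 1) 1 =
          SkewMonoidAlgebra.single (Multiplicative.ofAdd (n + 1)) a := by
      rw [SkewMonoidAlgebra.single_mul_single, smul_one, mul_one, ofAdd_add]
    exact (congrArg p h).mp (mul_X _ ih)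

theorem smul_mem_of_shift_le {M : ModuleCat.{u} (TwistedPoly φ)}
    {U : Submodule A ((under φ).obj M)} (hU : SemilinearOperator.shift (xMap M) U ≤ U)
    (f : TwistedPoly φ) : ∀ m : M, (show (under φ).obj M from m) ∈ U →
      (show (under φ).obj M from f • m) ∈ U := by
  induction f using induction_mul_X with
  | zero =>
    intro m _
    rw [zero_smul]
    exact U.zero_mem
  | const a => exact fun m hm => U.smul_mem a hm
  | mul_X f hf =>
    intro m hm
    rw [mul_smul]
    exact hf _ (hU (Submodule.subset_span ⟨m, hm, rfl⟩))
  | add f g hf hg =>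
    intro m hm
    rw [add_smul]
    exact U.add_mem (hf m hm) (hg m hm)

/-- Take the `A`-span of generators over `A[X]_φ`: an `A`-submodule containing its shift is an
`A[X]_φ`-submodule. -/
theorem exists_fg_generating (M : ModuleCat.{u} (TwistedPoly φ)) [Module.Finite (TwistedPoly φ) M] :
    ∃ W : Submodule A ((under φ).obj M), W.FG ∧
      ∀ U, W ≤ U → SemilinearOperator.shift (xMap M) U ≤ U → U = ⊤ := by
  obtain ⟨s, hs⟩ := (Module.finite_def (R := TwistedPoly φ) (M := M)).1 inferInstance
  refine ⟨Submodule.span A (show Set ((under φ).obj M) from (s : Set M)),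
    Submodule.fg_span s.finite_toSet, fun U hWU hU => ?_⟩
  let U' : Submodule (TwistedPoly φ) M :=
    { carrier := (U : Set ((under φ).obj M))
      add_mem' := fun ha hb => U.add_mem ha hb
      zero_mem' := U.zero_mem
      smul_mem' := fun f m hm => smul_mem_of_shift_le hU f m hm }
  have h : (⊤ : Submodule (TwistedPoly φ) M) ≤ U' := by
    rw [← hs, Submodule.span_le]
    exact fun m hm => hWU (Submodule.subset_span hm)
  exact eq_top_iff.2 fun m _ => h (Submodule.mem_top : (show M from m) ∈ ⊤)

variable [IsLocalRing A] [IsLocalHom φ] (hφ : ResidueField.map φ = RingHom.id (ResidueField A))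

/-- The top `Tor` over `A[X]_φ` is the socle. -/
theorem nonempty_torFunctor_equiv_socle {d : ℕ} {rs : List A} (hd : rs.length = d)
    (hrs : RingTheory.Sequence.IsWeaklyRegular A rs) (hm : Ideal.ofList rs = maximalIdeal A)
    (M : ModuleCat.{u} (TwistedPoly φ)) :
    Nonempty ((overBase A).obj ((torFunctor hφ d).obj M) ≃ₗ[A] socle A ((under φ).obj M)) := by
  obtain ⟨e₁⟩ := nonempty_torFunctor_iso hφ d M
  let P := underResolution (projectiveResolution M)
  let e₂ := P.isoLeftDerivedObj (Frobenius.residueTensor A) d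
  obtain ⟨e₃⟩ := nonempty_tor_equiv_socle hd hrs hm P
  exact ⟨e₁.toLinearEquiv.trans (e₂.toLinearEquiv.trans e₃)⟩

/-- A torsion-free `k[X]`-module which is finitely generated over `A` vanishes. -/
theorem subsingleton_of_finite_of_isTorsionFree [IsNoetherianRing A]
    (T : ModuleCat.{u} (ResidueField A)[X]) [Module.Finite A ((overBase A).obj T)]
    [Module.IsTorsionFree (ResidueField A)[X] T] : Subsingleton T := by
  rw [subsingleton_iff_forall_eq 0]
  intro t
  by_contra ht
  -- A nonzero `t` embeds `k[X]` into `T` by `p ↦ p • t`, which would make `k[X]` finite over `A`,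
  -- hence over `k`.
  let f : (ResidueField A)[X] →ₗ[A] (overBase A).obj T :=
    { toFun := fun p => show T from p • t
      map_add' := fun p q => add_smul p q t
      map_smul' := fun a p => by
        rw [Algebra.smul_def]
        exact mul_smul _ p t }
  have hinj : Function.Injective f := smul_left_injective (ResidueField A)[X] (M := T) ht
  have := Module.Finite.of_injective f hinj
  exact Polynomial.not_finite
    (Module.Finite.of_restrictScalars_finite A (ResidueField A) (ResidueField A)[X])

theorem finite_overBase (T : ModuleCat.{u} (ResidueField A)[X])
    [Module.Finite (ResidueField A) (overField.obj T)] :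
    Module.Finite A ((overBase A).obj T) := by
  obtain ⟨s, hs⟩ :=
    (Module.finite_def (R := ResidueField A) (M := overField.obj T)).1 inferInstance
  let U : Submodule A ((overBase A).obj T) :=
    Submodule.span A (show Set ((overBase A).obj T) from (s : Set (overField.obj T)))
  let U' : Submodule (ResidueField A) (overField.obj T) :=
    { carrier := (U : Set ((overBase A).obj T))
      add_mem' := fun ha hb => U.add_mem ha hb
      zero_mem' := U.zero_mem
      smul_mem' := fun c t ht => by
        obtain ⟨a, rfl⟩ := residue_surjective (R := A) c
        exact U.smul_mem a ht }
  have h : ⊤ ≤ U' := by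
    rw [← hs, Submodule.span_le]
    exact fun t ht => Submodule.subset_span (R := A) (M := (overBase A).obj T) ht
  have h1 : U = ⊤ := eq_top_iff.2 fun t _ =>
    h (Submodule.mem_top (R := ResidueField A) (M := overField.obj T) (x := t))
  have h2 : U.FG := Submodule.fg_span s.finite_toSet
  rw [h1] at h2
  exact Module.finite_def.2 h2

/-- If the degree zero `Tor` is finite-dimensional, the reduction modulo the maximal ideal is
finitely generated. -/
theorem finite_quotient_smul_top (M : ModuleCat.{u} (TwistedPoly φ))
    [Module.Finite (ResidueField A) (overField.obj ((torFunctor hφ 0).obj M))] :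
    Module.Finite A ((under φ).obj M ⧸ (maximalIdeal A • ⊤ : Submodule A ((under φ).obj M))) := by
  obtain ⟨e₁⟩ := nonempty_torFunctor_iso hφ 0 M
  have : Limits.PreservesFiniteColimits (Frobenius.residueTensor A) :=
    inferInstanceAs (Limits.PreservesFiniteColimits
      (MonoidalCategory.tensorLeft (ModuleCat.of A (ResidueField A))))
  let e₂ := (Frobenius.residueTensor A).leftDerivedZeroIsoSelf.app ((under φ).obj M)
  have := finite_overBase ((torFunctor hφ 0).obj M)
  have h : Module.Finite A (ResidueField A ⊗[A] (under φ).obj M) :=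
    Module.Finite.equiv (e₁.toLinearEquiv.trans e₂.toLinearEquiv)
  have h' : Module.Finite A ((A ⧸ maximalIdeal A) ⊗[A] (under φ).obj M) := h
  exact Module.Finite.equiv
    (TensorProduct.quotTensorEquivQuotSMul ((under φ).obj M) (maximalIdeal A))

/-- The key vanishing result. -/
theorem subsingleton_of_isTorsionFree [IsNoetherianRing A] (hflat : φ.Flat)
    {d : ℕ} {rs : List A} (hd : rs.length = d)
    (hrs : RingTheory.Sequence.IsWeaklyRegular A rs) (hm : Ideal.ofList rs = maximalIdeal A)
    {s : ℕ} (hs : maximalIdeal A ^ s ≤ (maximalIdeal A).map φ) (M : ModuleCat.{u} (TwistedPoly φ))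
    [Module.Finite (TwistedPoly φ) M] (hM : IsSmoothModule A ((under φ).obj M))
    (hfin : ∃ W : Submodule A ((under φ).obj M), W.FG ∧ ⊤ ≤ W ⊔ maximalIdeal A • ⊤)
    [htf : Module.IsTorsionFree (ResidueField A)[X] ((torFunctor hφ d).obj M)] :
    Subsingleton M := by
  have hF := lift_xMap_injective hφ hflat hd hrs hm hs M hM
    (htf.isSMulRegular (IsRegular.of_ne_zero Polynomial.X_ne_zero))
  obtain ⟨W₀, hW₀, hgen⟩ := exists_fg_generating M
  obtain ⟨W, hW, hWtop⟩ := hfin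
  -- `W` generates modulo `𝔪` and `W₀` generates over `A[X]_φ`; their sum does both.
  have hsoc := SemilinearOperator.socle_fg (xMap M) hflat hF
    (fun W => nonempty_socle_pull_equiv hd hrs hm hflat (residue_apply hφ) W) hM (hW.sup hW₀)
    (fun U hU => hgen U (le_sup_right.trans hU))
    (top_le_iff.1 (hWtop.trans (sup_le_sup_right le_sup_left _)))
  obtain ⟨e⟩ := nonempty_torFunctor_equiv_socle hφ hd hrs hm M
  have : Module.Finite A (socle A ((under φ).obj M)) := Module.Finite.iff_fg.2 hsoc
  have : Module.Finite A ((overBase A).obj ((torFunctor hφ d).obj M)) := Module.Finite.equiv e.symm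
  have hT := subsingleton_of_finite_of_isTorsionFree ((torFunctor hφ d).obj M)
  have hT' : Subsingleton (socle A ((under φ).obj M)) :=
    e.symm.injective.subsingleton (β := (torFunctor hφ d).obj M)
  exact hM.subsingleton_of_subsingleton_socle

end TwistedPoly

/-! ### Passage from `M` to the submodule `N` -/

namespace TwistedPoly

variable {A : Type u} [CommRing A] (φ : A →+* A)

/-- A module over `A[X]_φ` with a compatible structure over `A`, as the underlying module of an
object. -/
def underEquiv (M : Type u) [AddCommGroup M] [Module A M] [Module (TwistedPoly φ) M]
    [IsScalarTower A (TwistedPoly φ) M] :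
    M ≃ₗ[A] (under φ).obj (ModuleCat.of (TwistedPoly φ) M) where
  __ := AddEquiv.refl M
  map_smul' a m := by
    change a • m = C φ a • m
    rw [← mul_one (C φ a), ← smul_eq_C_mul, smul_assoc, one_smul]

variable {φ} [IsLocalRing A] [IsLocalHom φ]
  (hφ : ResidueField.map φ = RingHom.id (ResidueField A))

/-- The key vanishing result for submodules. -/
theorem subsingleton_of_injective_of_isTorsionFree [IsNoetherianRing A] (hflat : φ.Flat)
    {d : ℕ} {rs : List A} (hd : rs.length = d)
    (hrs : RingTheory.Sequence.IsWeaklyRegular A rs) (hm : Ideal.ofList rs = maximalIdeal A)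
    {s : ℕ} (hs : maximalIdeal A ^ s ≤ (maximalIdeal A).map φ) {N M : Type u}
    [AddCommGroup M] [Module A M] [Module (TwistedPoly φ) M] [IsScalarTower A (TwistedPoly φ) M]
    [AddCommGroup N] [Module A N] [Module (TwistedPoly φ) N] [IsScalarTower A (TwistedPoly φ) N]
    [Module.Finite (TwistedPoly φ) N] (hM : IsSmoothModule A M)
    (i : N →ₗ[A] M) (hi : Function.Injective i) [IsArtinian A (M ⧸ LinearMap.range i)]
    [Module.Finite (ResidueField A) (overField.obj (TorK hφ 0 M))]
    [Module.IsTorsionFree (ResidueField A)[X] (TorK hφ d N)] : Subsingleton N := by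
  let eM := underEquiv φ M
  let eN := underEquiv φ N
  have hfin := finite_quotient_smul_top hφ (ModuleCat.of (TwistedPoly φ) M)
  have hfin' : Module.Finite A (M ⧸ (maximalIdeal A • ⊤ : Submodule A M)) := by
    refine Module.Finite.equiv (Submodule.Quotient.equiv _ (maximalIdeal A •
      (⊤ : Submodule A ((under φ).obj (ModuleCat.of (TwistedPoly φ) M)))) eM ?_).symm
    rw [Submodule.map_smul'', Submodule.map_top, LinearEquiv.range]
  obtain ⟨W, hW, hWi, hWtop⟩ := exists_fg_sup_smul_of_isArtinian_quotient (LinearMap.range i) hfin'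
  have hmap : (W.comap i).map i = W := Submodule.map_comap_eq_of_le hWi
  have hWfg : (W.comap i).FG := Submodule.fg_of_fg_map_injective i hi (hmap.symm ▸ hW)
  have htop : (⊤ : Submodule A N) ≤ W.comap i ⊔ maximalIdeal A • ⊤ := by
    rw [← Submodule.map_le_map_iff_of_injective hi, Submodule.map_sup, Submodule.map_smul'',
      hmap, Submodule.map_top]
    exact hWtop
  refine subsingleton_of_isTorsionFree hφ hflat hd hrs hm hs (ModuleCat.of (TwistedPoly φ) N)
    ((hM.of_injective i hi).of_injective eN.symm.toLinearMap eN.symm.injective)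
    ⟨(W.comap i).map eN.toLinearMap, hWfg.map _, ?_⟩
  rw [← LinearEquiv.range eN, ← Submodule.map_top, ← Submodule.map_smul'', ← Submodule.map_sup]
  exact Submodule.map_mono htop

end TwistedPoly

end

/-! ### The theorem -/

theorem lemma3p2 (A : Type u) [CommRing A] [IsRegularLocalRing A]
    [IsAdicComplete (maximalIdeal A) A] (d : ℕ) (hd : ringKrullDim A = d)
    (φ : A →+* A) [IsLocalHom φ] (hflat : φ.Flat)
    (hφ : ResidueField.map φ = RingHom.id (ResidueField A)) :
    (∀ (M : Type u) [AddCommGroup M] [Module A M] [Module (TwistedPoly φ) M]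
        [IsScalarTower A (TwistedPoly φ) M] (N : Submodule (TwistedPoly φ) M),
        IsSmoothModule A M →
        Module.FinitePresentation (TwistedPoly φ) M →
        N ≠ ⊥ →
        Module.FinitePresentation (TwistedPoly φ) (M ⧸ N) →
        IsAdmissibleModule A (M ⧸ N) →
        Module.IsTorsionFree (ResidueField A)[X] (TwistedPoly.TorK hφ d N) →
        ¬ FiniteDimensional (ResidueField A)
          (TwistedPoly.overField.obj (TwistedPoly.TorK hφ 0 M))) ∧
    (∀ (M : Type u) [AddCommGroup M] [Module A M] [Module (TwistedPoly φ) M]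
        [IsScalarTower A (TwistedPoly φ) M],
        Nontrivial M →
        IsSmoothModule A M →
        Module.FinitePresentation (TwistedPoly φ) M →
        Module.IsTorsionFree (ResidueField A)[X] (TwistedPoly.TorK hφ d M) →
        ¬ FiniteDimensional (ResidueField A)
          (TwistedPoly.overField.obj (TwistedPoly.TorK hφ 0 M))) := by
  obtain ⟨rs, hlen, hrs, hm⟩ := IsRegularLocalRing.exists_isWeaklyRegular A d hd
  obtain ⟨s, hs⟩ := IsRegularLocalRing.exists_pow_le_map_maximalIdeal φ hflat
  refine ⟨fun M _ _ _ _ N hM hfp hN hfpq hadm htf hfin => hN ?_,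
    fun M _ _ _ _ hnt hM hfp htf hfin => ?_⟩
  -- The kernel of a surjection from a finitely generated module onto a finitely presented one is
  -- finitely generated.
  · have : Module.Finite (TwistedPoly φ) N := by
      rw [Module.Finite.iff_fg, ← N.ker_mkQ]
      exact Module.FinitePresentation.fg_ker N.mkQ N.mkQ_surjective
    let i : N →ₗ[A] M :=
      { toFun := Subtype.val
        map_add' := fun _ _ => rfl
        map_smul' := fun _ _ => rfl }
    have hr : LinearMap.range i = N.restrictScalars A := by
      ext v
      exact ⟨fun ⟨w, hw⟩ => hw ▸ w.2, fun hv => ⟨⟨v, hv⟩, rfl⟩⟩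
    have : IsArtinian A (M ⧸ N) := hadm.isArtinian
    have : IsArtinian A (M ⧸ LinearMap.range i) := by
      rw [hr]
      exact isArtinian_of_linearEquiv (Submodule.Quotient.restrictScalarsEquiv A N).symm
    have := TwistedPoly.subsingleton_of_injective_of_isTorsionFree hφ hflat hlen hrs hm hs hM i
      Subtype.val_injective
    exact (Submodule.subsingleton_iff_eq_bot).1 this
  -- For `N = M` the quotient is zero, hence Artinian.
  · have : IsArtinian A (M ⧸ LinearMap.range (LinearMap.id : M →ₗ[A] M)) := by
      rw [LinearMap.range_id]
      infer_instance
    exact not_subsingleton M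
      (TwistedPoly.subsingleton_of_injective_of_isTorsionFree hφ hflat hlen hrs hm hs hM
      (LinearMap.id : M →ₗ[A] M) Function.injective_id)
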